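/- **Setting.** Let $\mathcal M=(\mathcal X,\mathcal A,H,P,R)$ be an episodic MDP with $H\ge 1$ steps, fixed initial state $x_1$, transition kernels $P_h$ and reward distributions $R_h$ ($x_{h+1}\sim P_h(x_h,a_h)$, $r_h\sim R_h(x_h,a_h)$ independently given $(x_h,a_h)$), such that however actions are chosen, almost surely $r_h\ge 0$ and $\sum_{h=1}^H r_h\le 1$. Write $\mathbb E_\pi$ for the expectation over an episode in which actions follow $\pi$, and $V^\pi_h$, $Q^\pi_h$ for the value and Q-functions of a Markov policy $\pi$; $Q^\star_h=\sup_\pi Q^\pi_h$. Let $\mathcal F=\mathcal F_1\times\dots\times\mathcal F_H$, where $\mathcal F_h$ is a set of measurable functions $\mathcal X\times\mathcal A\to[0,1]$, and $\mathcal F_{H+1}=\{0\}$. The maxima $\max_a f_h(x,a)$ are attained, and $\pi^f$ denotes a measurable deterministic greedy policy of $f\in\mathcal F$, $\pi^f_h(x)\in\arg\max_a f_h(x,a)$ (ties broken in any fixed way); $\Pi_{\mathcal F}=\{\pi^f: f\in\mathcal F\}$. Put $(\mathcal T_h g)(x,a)=\mathbb E[r_h+\max_{a'}g(x_{h+1},a')\mid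 x_h=x,a_h=a]$ and $\mathcal E_hf=f_h-\mathcal T_hf_{h+1}$. Assume that $\mathcal F$ is realizable ($Q^\star_h\in\mathcal F_h$ for all $h\in[H]$) and complete ($\mathcal T_h g\in\mathcal F_h$ for all $h\in[H]$ and $g\in\mathcal F_{h+1}$). **Algorithm.** Let $\mathrm{expl}$ map each $f\in\mathcal F$ to a (possibly history-dependent) exploration policy. Before episode $t=1,2,\dots$ set $\hat f_{t,H+1}=0$ and, for $h=H,\dots,1$, let $\hat f_{t,h}$ be any minimizer over $f\in\mathcal F_h$ of $\sum_{s<t}\big(f(x_{s,h},a_{s,h})-r_{s,h}-\max_{a'}\hat f_{t,h+1}(x_{s,h+1},a')\big)^2$; then episode $t$ is sampled with the policy $\mathrm{expl}(\hat f_t)$, given the past. **Quantities.** For $f\in\mathcal F$ let $$\alpha(f,\mathcal F)=\sup_{\pi'\in\Pi_{\mathcal F},\,c\ge1}\tfrac1{\sqrt c}\big(V_1^{\pi'}(x_1)-V_1^{\pi^f}(x_1)\big)$$ subject to, for all $f'\in\mathcal F$ and $h\in[H]$, $$\mathbb E_{\pi'}[(\mathcal E_hf')^2(x_h,a_h)]\le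 c\,\mathbb E_{\mathrm{expl}(f)}[(\mathcal E_hf')^2(x_h,a_h)],\qquad \mathbb E_{\pi^f}[(\mathcal E_hf')^2(x_h,a_h)]\le c\,\mathbb E_{\mathrm{expl}(f)}[(\mathcal E_hf')^2(x_h,a_h)]$$ ($\alpha(f,\mathcal F)=0$ if the constraints are infeasible), and let $c(f,\mathcal F)$ be the smallest (infimal) $c$ for which some feasible $(\pi',c)$ attains this maximum ($c(f,\mathcal F)=\infty$ if it is not attained). For $\mathcal F'\subseteq\mathcal F$ let $\alpha(\mathcal F',\mathcal F)=\inf_{f\in\mathcal F'}\alpha(f,\mathcal F)$ and $c(\mathcal F',\mathcal F)=\sup_{f\in\mathcal F'}c(f,\mathcal F)$. For a set $\mathcal G$ of functions and a set $\mathcal P$ of probability measures, $\dim_{\mathrm{DE}}(\mathcal G,\mathcal P,\varepsilon)$ is the supremum of the lengths of sequences $\rho_1,\dots,\rho_n\in\mathcal P$ for which there is $\varepsilon'\ge\varepsilon$ such that for every $i$ some $g\in\mathcal G$ has $\big(\sum_{j<i}(\mathbb E_{\rho_j}g)^2\big)^{1/2}\le\varepsilon'<|\mathbb E_{\rho_i}g|$.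 Let $d=\dim_{\mathrm{BE}}(\mathcal F',\Pi_{\mathcal F},1/\sqrt T)=\max_{h\in[H]}\dim_{\mathrm{DE}}\big(\{\mathcal E_hf:f\in\mathcal F'\},\{\text{law of }(x_h,a_h)\text{ under }\pi:\pi\in\Pi_{\mathcal F}\},1/\sqrt T\big)$ be the Bellman–Eluder dimension. Let $\bar N_{\mathcal F}(\lambda)=\sum_{h=1}^HN_{\mathcal F_h}(\lambda)$, where $N_{\mathcal F_h}(\lambda)$ is the smallest size of a subset $Z\subseteq\mathcal F_h$ such that every $g\in\mathcal F_h$ is within sup-norm distance $\lambda$ of $Z$. **Theorem (Sample Complexity Upper Bound).** There is an absolute constant $C>0$ such that in every setting as above, for every $\delta\in(0,1)$, every integer $T\ge3$ and every $\mathcal F'\subseteq\mathcal F$, with probability at least $1-\delta$, $$\#\{t\le T:\hat f_t\in\mathcal F'\}\;\le\; C\,\frac{1+\ln c(\mathcal F',\mathcal F)}{\alpha(\mathcal F',\mathcal F)^2}\;H^2\,\max\{d,1\}\,\ln\Big(\frac{\bar N_{\mathcal F}(1/T)\,\ln T}{\delta}\Big),$$ where the right-hand side is $+\infty$ if $\mathcal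 F'\neq\varnothing$ and $\alpha(\mathcal F',\mathcal F)=0$ or one of $c(\mathcal F',\mathcal F)$, $d$, $\bar N_{\mathcal F}(1/T)$ is infinite, and the count is $0$ if $\mathcal F'=\varnothing$. -/

import Mathlib

open MeasureTheory ProbabilityTheory
open scoped ENNReal NNReal

noncomputable section

namespace MyopicRL

universe u v w

/-- The data of the first `n` steps `(x₁, a₁, r₁), …, (xₙ, aₙ, rₙ)` of an episode, together with the
current state `xₙ₊₁`.  Steps are numbered from `0` in the code.  For `n = H` this is a full
episode. -/
abbrev Hist (X : Type u) (A : Type v) (n : ℕ) : Type (max u v) := (Fin n → X × A × ℝ) × X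

section Hist

variable {X : Type u} {A : Type v} {n : ℕ}

/-- The state at step `h`; the state at step `n` is the current one. -/
def histState (e : Hist X A n) (h : ℕ) : X := if hh : h < n then (e.1 ⟨h, hh⟩).1 else e.2

/-- The action taken at step `h`. -/
def histAction (e : Hist X A n) (h : Fin n) : A := (e.1 h).2.1

/-- The reward received at step `h`. -/
def histReward (e : Hist X A n) (h : Fin n) : ℝ := (e.1 h).2.2

end Hist

/-- A sequence `f = (f_h)_h` of functions of a state and an action. -/
abbrev QFun (X : Type u) (A : Type v) : Type (max u v) := ℕ → X → A → ℝ

/-- An episodic Markov decision process with horizon `H`, fixed initial state, transition kernels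
`P_h` and reward distributions `R_h`.  Only the steps `h < H` are ever used. -/
structure MDP (X : Type u) (A : Type v) [MeasurableSpace X] [MeasurableSpace A] where
  H : ℕ
  H_pos : 0 < H
  init : X
  P : ℕ → Kernel (X × A) X
  R : ℕ → Kernel (X × A) ℝ
  markovP : ∀ h, IsMarkovKernel (P h)
  markovR : ∀ h, IsMarkovKernel (R h)

attribute [instance] MDP.markovP MDP.markovR

/-- A Markov policy: at step `h` a distribution over actions that depends on the state. -/
structure MarkovPolicy (X : Type u) (A : Type v) [MeasurableSpace X] [MeasurableSpace A] where
  kernel : ℕ → Kernel X A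
  markov : ∀ h, IsMarkovKernel (kernel h)

attribute [instance] MarkovPolicy.markov

/-- A general policy: at step `h` a distribution over actions that may depend on the whole
history of the episode. -/
structure Policy (X : Type u) (A : Type v) [MeasurableSpace X] [MeasurableSpace A] where
  kernel : (h : ℕ) → Kernel (Hist X A h) A
  markov : ∀ h, IsMarkovKernel (kernel h)

attribute [instance] Policy.markov

/-- A Markov policy as a general policy. -/
def MarkovPolicy.toPolicy {X : Type u} {A : Type v} [MeasurableSpace X] [MeasurableSpace A]
    (π : MarkovPolicy X A) : Policy X A where
  kernel h := (π.kernel h).comap Prod.snd measurable_snd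
  markov _ := inferInstance

namespace MDP

variable {X : Type u} {A : Type v} [MeasurableSpace X] [MeasurableSpace A] (M : MDP X A)

/-- The joint law of reward and next state given the history and the action. -/
def stepKernel (n : ℕ) : Kernel (Hist X A n × A) (ℝ × X) :=
  (M.R n ×ₖ M.P n).comap (fun p => (p.1.2, p.2)) (by fun_prop)

/-- The law of the first `n` steps of an episode in which actions are drawn from `π`.  For `n = H`
this is the law `ℙ_π` of an episode. -/
def histLaw (π : Policy X A) : (n : ℕ) → Measure (Hist X A n)
  | 0 => Measure.dirac (Fin.elim0, M.init)
  | n + 1 =>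
    ((histLaw π n ⊗ₘ π.kernel n) ⊗ₘ M.stepKernel n).map
      (fun q => (Fin.snoc (α := fun _ => X × A × ℝ) q.1.1.1 (q.1.1.2, q.1.2, q.2.1), q.2.2))

/-- The law of the pair `(x_h, a_h)` under `ℙ_π`. -/
def occupancy (π : Policy X A) (h : ℕ) : Measure (X × A) :=
  (M.histLaw π h ⊗ₘ π.kernel h).map (fun p => (p.1.2, p.2))

/-- Rewards are nonnegative and sum to at most `1` almost surely, however actions are chosen. -/
def RewardsBounded : Prop :=
  ∀ π : Policy X A, ∀ᵐ e ∂(M.histLaw π M.H),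
    (∀ h : Fin M.H, 0 ≤ histReward e h) ∧ ∑ h : Fin M.H, histReward e h ≤ 1

/-- The mean reward at step `h`. -/
def meanReward (h : ℕ) (x : X) (a : A) : ℝ := ∫ r, r ∂(M.R h (x, a))

/-- The value function `V_h^π`, with `V_H^π = 0` (steps are numbered from `0`). -/
def value (π : MarkovPolicy X A) (h : ℕ) (x : X) : ℝ :=
  if h < M.H then
    ∫ a, (M.meanReward h x a + ∫ x', value π (h + 1) x' ∂(M.P h (x, a))) ∂(π.kernel h x)
  else 0
termination_by M.H - h

/-- The Q-function `Q_h^π`. -/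
def qValue (π : MarkovPolicy X A) (h : ℕ) (x : X) (a : A) : ℝ :=
  M.meanReward h x a + ∫ x', M.value π (h + 1) x' ∂(M.P h (x, a))

/-- The optimal Q-function `Q_h^⋆`. -/
def qStar (h : ℕ) (x : X) (a : A) : ℝ := ⨆ π : MarkovPolicy X A, M.qValue π h x a

/-- The Bellman operator `𝒯_h`. -/
def bellman (h : ℕ) (f : X → A → ℝ) (x : X) (a : A) : ℝ :=
  M.meanReward h x a + ∫ x', (⨆ a', f x' a') ∂(M.P h (x, a))

/-- The Bellman residual `ℰ_h f = f_h - 𝒯_h f_{h+1}`. -/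
def residual (h : ℕ) (f : QFun X A) (x : X) (a : A) : ℝ :=
  f h x a - M.bellman h (f (h + 1)) x a

/-- `𝔼_π[(ℰ_h² f)(x_h, a_h)]`. -/
def sqError (π : Policy X A) (h : ℕ) (f : QFun X A) : ℝ :=
  ∫ z, (M.residual h f z.1 z.2) ^ 2 ∂(M.occupancy π h)

/-- The factors `F_h` (for `h < H`) of a Q-function class consist of measurable functions into
`[0, 1]`; beyond the horizon the only function is `0`.  The class itself is the product
`Set.univ.pi F`. -/
def IsValueClass (F : ℕ → Set (X → A → ℝ)) : Prop :=
  (∀ h < M.H, ∀ f ∈ F h,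
    Measurable (Function.uncurry f) ∧ ∀ x a, 0 ≤ f x a ∧ f x a ≤ 1) ∧
  ∀ h, M.H ≤ h → F h = {fun _ _ => 0}

/-- Realizability: `Q_h^⋆ ∈ F_h` for every step. -/
def Realizable (F : ℕ → Set (X → A → ℝ)) : Prop := ∀ h < M.H, M.qStar h ∈ F h

/-- Completeness under the Bellman operators. -/
def BellmanComplete (F : ℕ → Set (X → A → ℝ)) : Prop :=
  ∀ h < M.H, ∀ g ∈ F (h + 1), ∃ f ∈ F h, f = M.bellman h g

/-- `π` deterministically plays an action that maximizes `f_h(x, ·)`. -/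
def IsGreedy (f : QFun X A) (π : MarkovPolicy X A) : Prop :=
  ∀ h < M.H, ∀ x, ∃ a, π.kernel h x = Measure.dirac a ∧ ∀ a', f h x a' ≤ f h x a

/-- The constraints on `(π', c)` in the optimization problem that defines the myopic exploration
gap of `f`; `πf` is the greedy policy of `f` and `πe` the exploration policy of `f`. -/
def GapFeasible (F : ℕ → Set (X → A → ℝ)) (πf : MarkovPolicy X A) (πe : Policy X A)
    (π' : MarkovPolicy X A) (c : ℝ) : Prop :=
  1 ≤ c ∧ ∀ f' ∈ Set.univ.pi F, ∀ h < M.H,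
    M.sqError π'.toPolicy h f' ≤ c * M.sqError πe h f' ∧
    M.sqError πf.toPolicy h f' ≤ c * M.sqError πe h f'

/-- The objective of that problem. -/
def gapObjective (πf π' : MarkovPolicy X A) (c : ℝ) : ℝ :=
  1 / √c * (M.value π' 0 M.init - M.value πf 0 M.init)

/-- The myopic exploration gap `α(f, 𝓕, Pc)`; it is `0` if the constraints are infeasible. -/
def gap (F : ℕ → Set (X → A → ℝ)) (Pc : Set (MarkovPolicy X A))
    (greedy : QFun X A → MarkovPolicy X A) (expl : QFun X A → Policy X A) (f : QFun X A) : ℝ :=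
  sSup {v | ∃ π' ∈ Pc, ∃ c, M.GapFeasible F (greedy f) (expl f) π' c ∧
    v = M.gapObjective (greedy f) π' c}

/-- The myopic exploration radius `c(f, 𝓕, Pc)`: the smallest `c` that attains the maximum (`∞` if
the maximum is not attained). -/
def radius (F : ℕ → Set (X → A → ℝ)) (Pc : Set (MarkovPolicy X A))
    (greedy : QFun X A → MarkovPolicy X A) (expl : QFun X A → Policy X A) (f : QFun X A) : ℝ≥0∞ :=
  sInf {v | ∃ π' ∈ Pc, ∃ c, M.GapFeasible F (greedy f) (expl f) π' c ∧
    M.gapObjective (greedy f) π' c = M.gap F Pc greedy expl f ∧ v = ENNReal.ofReal c}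

/-- `α(𝓕', 𝓕)`: the infimum over `f ∈ 𝓕'` of the gaps with respect to the greedy policies of
`𝓕`. -/
def minGap (F : ℕ → Set (X → A → ℝ)) (greedy : QFun X A → MarkovPolicy X A)
    (expl : QFun X A → Policy X A) (F' : Set (QFun X A)) : ℝ≥0∞ :=
  ⨅ f ∈ F', ENNReal.ofReal (M.gap F (greedy '' Set.univ.pi F) greedy expl f)

/-- `c(𝓕', 𝓕)`: the supremum over `f ∈ 𝓕'` of the radii with respect to the greedy policies of
`𝓕`. -/
def maxRadius (F : ℕ → Set (X → A → ℝ)) (greedy : QFun X A → MarkovPolicy X A)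
    (expl : QFun X A → Policy X A) (F' : Set (QFun X A)) : ℝ≥0∞ :=
  ⨆ f ∈ F', M.radius F (greedy '' Set.univ.pi F) greedy expl f

/-- The least-squares loss `ℒ_h(f, f')` on the transitions at step `h` of the episodes `D`. -/
def loss {t : ℕ} (D : Fin t → Hist X A M.H) (h : Fin M.H) (f f' : X → A → ℝ) : ℝ :=
  ∑ s, (f (histState (D s) h) (histAction (D s) h) - histReward (D s) h
    - ⨆ a', f' (histState (D s) (h + 1)) a') ^ 2

/-- `f` is an output of fitted-Q iteration over the class `F` on the episodes `D`: backwards from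
`f_H = 0`, each `f_h` is a least-squares fit. -/
def IsFittedQ {t : ℕ} (F : ℕ → Set (X → A → ℝ)) (D : Fin t → Hist X A M.H) (f : QFun X A) : Prop :=
  f ∈ Set.univ.pi F ∧
    ∀ h : Fin M.H, ∀ g ∈ F h, M.loss D h (f h) (f (h + 1)) ≤ M.loss D h g (f (h + 1))

/-- `(episode t, fhat t)`, `t = 0, 1, …`, is a run of reinforcement learning with myopic exploration:
before episode `t`, the estimate `fhat t` is computed by fitted-Q iteration from the previous
episodes (ties are broken in any way), and, given the past `ℱ t`, episode `t` is drawn from the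
exploration policy `expl (fhat t)`. -/
structure IsRun {Ω : Type w} [mΩ : MeasurableSpace Ω] (F : ℕ → Set (X → A → ℝ))
    (expl : QFun X A → Policy X A) (μ : Measure Ω) (ℱ : Filtration ℕ mΩ)
    (episode : ℕ → Ω → Hist X A M.H) (fhat : ℕ → Ω → QFun X A) : Prop where
  adapted : ∀ t, Measurable[ℱ (t + 1)] (episode t)
  fit : ∀ t, ∀ᵐ ω ∂μ, M.IsFittedQ F (fun s : Fin t => episode s ω) (fhat t ω)
  sample : ∀ t, ∀ S : Set (Hist X A M.H), MeasurableSet S →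
    μ[(episode t ⁻¹' S).indicator (fun _ => (1 : ℝ)) | ℱ t]
      =ᵐ[μ] fun ω => (M.histLaw (expl (fhat t ω)) M.H).real S

end MDP

/-- `ν` is `ε`-independent of `ρ₁, …, ρₙ` with respect to the function class `G`. -/
def EpsIndependent {Z : Type u} [MeasurableSpace Z] (G : Set (Z → ℝ)) (ε : ℝ) {n : ℕ}
    (ρ : Fin n → Measure Z) (ν : Measure Z) : Prop :=
  ∃ g ∈ G, √(∑ i, (∫ z, g z ∂(ρ i)) ^ 2) ≤ ε ∧ ε < |∫ z, g z ∂ν|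

/-- The distributional Eluder dimension: the length of the longest sequence in `Pc` for which there is
an `ε' ≥ ε` such that each member is `ε'`-independent of its predecessors. -/
def deDim {Z : Type u} [MeasurableSpace Z] (G : Set (Z → ℝ)) (Pc : Set (Measure Z)) (ε : ℝ) : ℕ∞ :=
  sSup {k | ∃ n : ℕ, k = n ∧ ∃ ρ : Fin n → Measure Z, (∀ i, ρ i ∈ Pc) ∧ ∃ ε', ε ≤ ε' ∧
    ∀ i : Fin n, EpsIndependent G ε' (fun j : Fin i => ρ (j.castLE i.isLt.le)) (ρ i)}

/-- The Bellman–Eluder dimension of `F'` with respect to the laws of `(x_h, a_h)` induced by the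
policies in `Pc`. -/
def MDP.beDim {X : Type u} {A : Type v} [MeasurableSpace X] [MeasurableSpace A] (M : MDP X A)
    (F' : Set (QFun X A)) (Pc : Set (MarkovPolicy X A)) (ε : ℝ) : ℕ∞ :=
  ⨆ h : Fin M.H, deDim ((fun f => fun z : X × A => M.residual h f z.1 z.2) '' F')
    ((fun π => M.occupancy π.toPolicy h) '' Pc) ε

/-- The covering number of `G` in the supremum norm at radius `lam`, with centers in `G`. -/
def coveringNumber {X : Type u} {A : Type v} (G : Set (X → A → ℝ)) (lam : ℝ) : ℕ∞ :=
  sInf {k | ∃ Z ⊆ G, (∀ f ∈ G, ∃ f' ∈ Z, ∀ x a, |f x a - f' x a| ≤ lam) ∧ k = Z.encard}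

/-- `N̄_𝓕(lam) = ∑_h N_{𝓕_h}(lam)`. -/
def MDP.sumCovering {X : Type u} {A : Type v} [MeasurableSpace X] [MeasurableSpace A] (M : MDP X A)
    (F : ℕ → Set (X → A → ℝ)) (lam : ℝ) : ℕ∞ :=
  ∑ h : Fin M.H, coveringNumber (F h) lam

/-- The natural logarithm on `[0, ∞]`, cut off below at `0`, with `ln ∞ = ∞`. -/
def lnPos (x : ℝ≥0∞) : ℝ≥0∞ := (ENNReal.log x).toENNReal

end MyopicRL

end

noncomputable section

namespace MyopicRL

universe u v w

/-! Two facts about each estimate are played against each other: its Bellman residuals are small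
under the past exploration policies, and a positive exploration gap forces a large residual now. The
Bellman–Eluder dimension limits how often both can happen.

Small residuals. For a fixed pair `(f, g)`, the excess square loss of `f` over `𝒯_h g` has
conditional mean equal to the squared Bellman error, and its variance is of the same order. Hence
`exp(-excess/50)` has conditional mean at most `exp(-error/100)`, and Ville's inequality makes the
comparison uniform in time (`measure_sqGap_gt_le`). By completeness, `𝒯_h` of the next estimate
competes in the least-squares fit, so the total excess of an estimate is nonpositive. A union bound
over pairs of `1/T`-cover centers then bounds its summed squared errors by `28 + 100 L`
(`measure_sqError_le`).

Large residuals. Telescoping along an episode bounds `V^{π'} - V^{π^f}` by the absolute mean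
residuals of `f` under `π'` and `π^f` (`value_sub_value_le`). The gap makes this difference at least
`√c α`. Feasibility transfers the small squared errors from the exploration policy to both `π'` and
`π^f`, at the cost of a factor `c`.

Counting. A colouring argument and dyadic layers turn the Eluder dimension into a bound on the sum
of mean residuals (`sum_abs_integral_le`). Among episodes with `c` in `[c₀, 2c₀]` the factor `c₀`
lost by feasibility cancels against the square of the `√c₀` gained in value, leaving order `d β H² /
α²` episodes (`card_le_of_radius_class`). Order `1 + ln c(𝓕', 𝓕)` dyadic classes of `c` suffice. -/

/-! ### Regularity of the function classes -/

lemma ciSup_eq_of_forall_le {A : Type v} {g : A → ℝ} {a : A} (h : ∀ a', g a' ≤ g a) : ⨆ a', g a' = g a := by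
  have : Nonempty A := ⟨a⟩
  exact le_antisymm (ciSup_le h) (le_ciSup (f := g) ⟨g a, by rintro _ ⟨b, rfl⟩; exact h b⟩ a)

/-- A complete class of measurable `[0, 1]`-valued functions whose maxima over actions are attained
and measurable in the state. -/
structure MDP.RegularClass {X : Type u} {A : Type v} [MeasurableSpace X] [MeasurableSpace A]
    (M : MDP X A) (F : ℕ → Set (X → A → ℝ)) : Prop where
  meas : ∀ h, ∀ g ∈ F h, Measurable (Function.uncurry g)
  mem01 : ∀ h, ∀ g ∈ F h, ∀ x a, 0 ≤ g x a ∧ g x a ≤ 1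
  attained : ∀ h, ∀ g ∈ F h, ∀ x, ∃ a, ∀ a', g x a' ≤ g x a
  sup_meas : ∀ h, ∀ g ∈ F h, Measurable (fun x => ⨆ a, g x a)
  complete : ∀ h < M.H, ∀ g ∈ F (h + 1), M.bellman h g ∈ F h
  zero : ∀ h, M.H ≤ h → F h = {fun _ _ => 0}
  nonempty : ∀ h, (F h).Nonempty

namespace MDP

variable {X : Type u} {A : Type v} [MeasurableSpace X] [MeasurableSpace A] {M : MDP X A}
  {F : ℕ → Set (X → A → ℝ)}

lemma IsGreedy.ciSup_eq_integral {f : QFun X A} {π : MarkovPolicy X A} (hπ : M.IsGreedy f π)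
    {h : ℕ} (hh : h < M.H) (hf : Measurable (Function.uncurry (f h))) (x : X) :
    ⨆ a, f h x a = ∫ a, f h x a ∂(π.kernel h x) := by
  obtain ⟨a, ha, hmax⟩ := hπ h hh x
  have hm : Measurable (f h x) := hf.comp measurable_prodMk_left
  rw [ciSup_eq_of_forall_le hmax, ha, integral_dirac' _ _ hm.stronglyMeasurable]

/-- Attainment and measurability of the maxima come from the greedy policies: the maximum of `f_h(x,
·)` is its integral against the greedy kernel, hence measurable in `x`. -/
lemma regularClass (hF : M.IsValueClass F) (hR : M.Realizable F) (hC : M.BellmanComplete F)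
    {greedy : QFun X A → MarkovPolicy X A}
    (hg : ∀ f ∈ Set.univ.pi F, M.IsGreedy f (greedy f)) : M.RegularClass F := by
  have hne : ∀ h, (F h).Nonempty := by
    intro h
    by_cases hh : h < M.H
    · exact ⟨_, hR h hh⟩
    · rw [hF.2 h (not_lt.1 hh)]; exact Set.singleton_nonempty _
  -- Greediness concerns whole tuples, so a single `g ∈ F h` is completed to a member of the
  -- product.
  have hext : ∀ h, ∀ g ∈ F h, ∃ f ∈ Set.univ.pi F, f h = g := by
    intro h g hgF
    choose f0 hf0 using hne
    refine ⟨Function.update f0 h g, ?_, by simp⟩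
    intro k _
    by_cases hk : k = h
    · subst hk; simpa using hgF
    · simpa [Function.update_of_ne hk] using hf0 k
  have hmeas : ∀ h, ∀ g ∈ F h, Measurable (Function.uncurry g) := by
    intro h g hgF
    by_cases hh : h < M.H
    · exact (hF.1 h hh g hgF).1
    · rw [hF.2 h (not_lt.1 hh)] at hgF
      rw [Set.mem_singleton_iff.1 hgF]
      exact measurable_const
  refine ⟨hmeas, ?_, ?_, ?_, ?_, hF.2, hne⟩
  · intro h g hgF
    by_cases hh : h < M.H
    · exact (hF.1 h hh g hgF).2
    · rw [hF.2 h (not_lt.1 hh)] at hgF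
      rw [Set.mem_singleton_iff.1 hgF]
      simp
  · intro h g hgF x
    by_cases hh : h < M.H
    · obtain ⟨f, hf, rfl⟩ := hext h g hgF
      obtain ⟨a, -, ha⟩ := hg f hf h hh x
      exact ⟨a, ha⟩
    · rw [hF.2 h (not_lt.1 hh)] at hgF
      rw [Set.mem_singleton_iff.1 hgF]
      -- Beyond the horizon greediness says nothing; the greedy policy at step `0` merely supplies
      -- some action, and any action maximizes the zero function.
      obtain ⟨f, hf, -⟩ := hext 0 _ (hne 0).some_mem
      obtain ⟨a, -, -⟩ := hg f hf 0 M.H_pos x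
      exact ⟨a, by simp⟩
  · intro h g hgF
    by_cases hh : h < M.H
    · obtain ⟨f, hf, rfl⟩ := hext h g hgF
      have : (fun x => ⨆ a, f h x a) = fun x => ∫ a, f h x a ∂((greedy f).kernel h x) := by
        funext x
        exact (hg f hf).ciSup_eq_integral hh (hmeas h _ hgF) x
      rw [this]
      exact ((hmeas h _ hgF).stronglyMeasurable.integral_kernel_prod_right).measurable
    · rw [hF.2 h (not_lt.1 hh)] at hgF
      rw [Set.mem_singleton_iff.1 hgF]
      exact measurable_const
  · intro h hh g hgF
    obtain ⟨f, hf, rfl⟩ := hC h hh g hgF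
    exact hf

namespace RegularClass

variable (hF : M.RegularClass F)
include hF

lemma ciSup_mem01 {h : ℕ} {g : X → A → ℝ} (hg : g ∈ F h) (x : X) :
    0 ≤ ⨆ a, g x a ∧ ⨆ a, g x a ≤ 1 := by
  obtain ⟨a, ha⟩ := hF.attained h g hg x
  rw [ciSup_eq_of_forall_le ha]
  exact hF.mem01 h g hg x a

lemma le_ciSup {h : ℕ} {g : X → A → ℝ} (hg : g ∈ F h) (x : X) (a : A) :
    g x a ≤ ⨆ a', g x a' := by
  obtain ⟨b, hb⟩ := hF.attained h g hg x
  rw [ciSup_eq_of_forall_le hb]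
  exact hb a

lemma abs_ciSup_sub_le {h : ℕ} {g g' : X → A → ℝ} (hg : g ∈ F h) (hg' : g' ∈ F h) {lam : ℝ}
    (hl : ∀ x a, |g x a - g' x a| ≤ lam) (x : X) : |(⨆ a, g x a) - ⨆ a, g' x a| ≤ lam := by
  obtain ⟨a, ha⟩ := hF.attained h g hg x
  obtain ⟨b, hb⟩ := hF.attained h g' hg' x
  rw [ciSup_eq_of_forall_le ha, ciSup_eq_of_forall_le hb, abs_le]
  have h1 := abs_le.1 (hl x a)
  have h2 := abs_le.1 (hl x b)
  constructor <;> linarith [ha b, hb a]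

lemma integrable_ciSup {h : ℕ} {g : X → A → ℝ} (hg : g ∈ F h) (ν : Measure X)
    [IsFiniteMeasure ν] : Integrable (fun x => ⨆ a, g x a) ν :=
  Integrable.of_bound (hF.sup_meas h g hg).aestronglyMeasurable 1 (ae_of_all _ fun x => by
    rw [Real.norm_eq_abs, abs_le]; have := hF.ciSup_mem01 hg x; constructor <;> linarith)

lemma abs_bellman_sub_le {h : ℕ} {g g' : X → A → ℝ} (hg : g ∈ F h) (hg' : g' ∈ F h) {lam : ℝ}
    (hl : ∀ x a, |g x a - g' x a| ≤ lam) (k : ℕ) (x : X) (a : A) :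
    |M.bellman k g x a - M.bellman k g' x a| ≤ lam := by
  have : M.bellman k g x a - M.bellman k g' x a
      = ∫ x', ((⨆ a', g x' a') - ⨆ a', g' x' a') ∂(M.P k (x, a)) := by
    rw [integral_sub (hF.integrable_ciSup hg _) (hF.integrable_ciSup hg' _)]
    simp [bellman]
  rw [this, ← Real.norm_eq_abs]
  refine (norm_integral_le_of_norm_le_const (C := lam) (ae_of_all _ fun x' => ?_)).trans (by simp)
  exact hF.abs_ciSup_sub_le hg hg' hl x'

/-- The assumption on rewards says nothing at unreachable pairs `(x, a)`. Completeness does: the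
Bellman backup and its next-state integral both lie in `[0, 1]`, and the mean reward is their
difference. -/
lemma abs_meanReward_le {h : ℕ} (hh : h < M.H) (x : X) (a : A) : |M.meanReward h x a| ≤ 1 := by
  obtain ⟨g, hg⟩ := hF.nonempty (h + 1)
  have h1 := hF.mem01 h _ (hF.complete h hh g hg) x a
  have h2 : 0 ≤ ∫ x', (⨆ a', g x' a') ∂(M.P h (x, a)) :=
    integral_nonneg fun x' => (hF.ciSup_mem01 hg x').1
  have h3 : ∫ x', (⨆ a', g x' a') ∂(M.P h (x, a)) ≤ 1 := by
    refine (integral_mono (hF.integrable_ciSup hg _) (integrable_const 1)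
      fun x' => (hF.ciSup_mem01 hg x').2).trans (by simp)
  simp only [bellman] at h1
  rw [abs_le]
  constructor <;> linarith

lemma measurable_residual {h : ℕ} (hh : h < M.H) {f : QFun X A} (hf : f ∈ Set.univ.pi F) :
    Measurable fun z : X × A => M.residual h f z.1 z.2 :=
  (hF.meas h _ (hf h trivial)).sub (hF.meas h _ (hF.complete h hh _ (hf (h + 1) trivial)))

lemma abs_residual_le {h : ℕ} (hh : h < M.H) {f : QFun X A} (hf : f ∈ Set.univ.pi F) (x : X)
    (a : A) : |M.residual h f x a| ≤ 1 := by
  have h1 := hF.mem01 h _ (hf h trivial) x a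
  have h2 := hF.mem01 h _ (hF.complete h hh _ (hf (h + 1) trivial)) x a
  rw [abs_le, residual]
  constructor <;> linarith

lemma integrable_residual {h : ℕ} (hh : h < M.H) {f : QFun X A} (hf : f ∈ Set.univ.pi F)
    (ν : Measure (X × A)) [IsFiniteMeasure ν] :
    Integrable (fun z : X × A => M.residual h f z.1 z.2) ν :=
  Integrable.of_bound (hF.measurable_residual hh hf).aestronglyMeasurable 1
    (ae_of_all _ fun z => hF.abs_residual_le hh hf z.1 z.2)

end RegularClass

/-! ### Laws of episodes and of single transitions -/

lemma measurable_meanReward (h : ℕ) : Measurable fun z : X × A => M.meanReward h z.1 z.2 :=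
  (stronglyMeasurable_id.integral_kernel (κ := M.R h)).measurable

lemma measurable_snocHist (n : ℕ) : Measurable
    (fun q : (Hist X A n × A) × (ℝ × X) =>
      ((Fin.snoc (α := fun _ => X × A × ℝ) q.1.1.1 (q.1.1.2, q.1.2, q.2.1), q.2.2) :
        Hist X A (n + 1))) := by
  refine Measurable.prodMk ?_ (by fun_prop)
  refine measurable_pi_lambda _ fun i => ?_
  refine Fin.lastCases ?_ (fun j => ?_) i
  · simp only [Fin.snoc_last]; fun_prop
  · simp only [Fin.snoc_castSucc]; fun_prop

instance (n : ℕ) : IsMarkovKernel (M.stepKernel n) := by unfold stepKernel; infer_instance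

instance isProbabilityMeasure_histLaw (π : Policy X A) :
    ∀ n, IsProbabilityMeasure (M.histLaw π n)
  | 0 => by unfold histLaw; infer_instance
  | n + 1 => by
    have := isProbabilityMeasure_histLaw π n
    unfold histLaw
    exact Measure.isProbabilityMeasure_map (measurable_snocHist n).aemeasurable

instance (π : Policy X A) (h : ℕ) : IsProbabilityMeasure (M.occupancy π h) := by
  unfold occupancy
  exact Measure.isProbabilityMeasure_map (by fun_prop)

lemma measurable_histState (n h : ℕ) : Measurable fun e : Hist X A n => histState e h := by
  unfold histState
  split_ifs with hh
  · fun_prop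
  · fun_prop

/-- The state, action, reward and next state of step `h`. -/
def stepData {n : ℕ} (h : Fin n) (e : Hist X A n) : (X × A) × (ℝ × X) :=
  ((histState e h, histAction e h), (histReward e h, histState e (h + 1)))

lemma measurable_stepData {n : ℕ} (h : Fin n) :
    Measurable (stepData (X := X) (A := A) h) := by
  have h1 : Measurable fun e : Hist X A n => histAction e h := by unfold histAction; fun_prop
  have h2 : Measurable fun e : Hist X A n => histReward e h := by unfold histReward; fun_prop
  exact ((measurable_histState n h).prodMk h1).prodMk (h2.prodMk (measurable_histState n _))

/-- Induction on the length of the history: the last transition is read off the construction of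
`histLaw`, and an earlier one does not see the appended step. -/
lemma map_stepData_histLaw (π : Policy X A) {n : ℕ} (h : Fin n) :
    (M.histLaw π n).map (stepData h) = M.occupancy π h ⊗ₘ (M.R h ×ₖ M.P h) := by
  induction n with
  | zero => exact h.elim0
  | succ n ih =>
    rw [histLaw, Measure.map_map (measurable_stepData h) (measurable_snocHist n)]
    refine Fin.lastCases ?_ (fun j => ?_) h
    · have : stepData (X := X) (A := A) (Fin.last n) ∘ (fun q : (Hist X A n × A) × (ℝ × X) =>
          ((Fin.snoc (α := fun _ => X × A × ℝ) q.1.1.1 (q.1.1.2, q.1.2, q.2.1), q.2.2) :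
            Hist X A (n + 1)))
          = Prod.map (fun p : Hist X A n × A => (p.1.2, p.2)) id := by
        funext q
        simp [stepData, histState, histAction, histReward, Fin.snoc]
        rfl
      rw [this]
      ext s hs
      rw [Measure.map_apply (by fun_prop) hs, Measure.compProd_apply hs,
        Measure.compProd_apply (hs.preimage (by fun_prop)), Fin.val_last, occupancy,
        lintegral_map (Kernel.measurable_kernel_prodMk_left hs) (by fun_prop)]
      rfl
    · have : stepData (X := X) (A := A) j.castSucc ∘ (fun q : (Hist X A n × A) × (ℝ × X) =>
          ((Fin.snoc (α := fun _ => X × A × ℝ) q.1.1.1 (q.1.1.2, q.1.2, q.2.1), q.2.2) :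
            Hist X A (n + 1)))
          = stepData j ∘ Prod.fst ∘ Prod.fst := by
        funext q
        have hj := j.isLt
        have hj' : (j : ℕ) < n + 1 := by omega
        have e1 : (⟨j, hj'⟩ : Fin (n + 1)) = j.castSucc := rfl
        simp only [stepData, histState, histAction, histReward, Function.comp, Fin.val_castSucc,
          hj, hj', dite_true, e1, Fin.snoc_castSucc, Fin.eta]
        congr 2
        -- When `j + 1 = n`, the next state of step `j` is the current state of the shorter history,
        -- which becomes the state stored in the appended entry.
        by_cases hj1 : (j : ℕ) + 1 < n
        · have e2 : (⟨j + 1, by omega⟩ : Fin (n + 1)) = (⟨j + 1, hj1⟩ : Fin n).castSucc := rfl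
          rw [dif_pos (by omega), dif_pos hj1, e2, Fin.snoc_castSucc]
        · have hjn : (j : ℕ) + 1 = n := by omega
          have e2 : (⟨j + 1, by omega⟩ : Fin (n + 1)) = Fin.last n := Fin.ext hjn
          rw [dif_pos (by omega), dif_neg hj1, e2, Fin.snoc_last]
      rw [this, ← Measure.map_map (measurable_stepData j) (by fun_prop),
        ← Measure.map_map (by fun_prop) (by fun_prop)]
      have h1 : ((M.histLaw π n ⊗ₘ π.kernel n) ⊗ₘ M.stepKernel n).map Prod.fst
          = M.histLaw π n ⊗ₘ π.kernel n := Measure.fst_compProd _ _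
      have h2 : (M.histLaw π n ⊗ₘ π.kernel n).map Prod.fst = M.histLaw π n :=
        Measure.fst_compProd _ _
      rw [h1, h2, ih j, Fin.val_castSucc]

end MDP

/-! ### Value functions and the decomposition into Bellman residuals -/

namespace MDP

variable {X : Type u} {A : Type v} [MeasurableSpace X] [MeasurableSpace A] {M : MDP X A}
  {F : ℕ → Set (X → A → ℝ)}

lemma integrable_integral_of_compProd {α β : Type*} {mα : MeasurableSpace α}
    {mβ : MeasurableSpace β} {ν : Measure α} [SFinite ν] {κ : Kernel α β} [IsSFiniteKernel κ]
    {φ : α × β → ℝ} (hφ : Integrable φ (ν ⊗ₘ κ)) : Integrable (fun a => ∫ b, φ (a, b) ∂(κ a)) ν := by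
  rw [Measure.compProd] at hφ
  simpa using hφ.integral_compProd

/-- The law of the state at step `h`. -/
def stateLaw (M : MDP X A) (π : Policy X A) (h : ℕ) : Measure X := (M.histLaw π h).map Prod.snd

instance (π : Policy X A) (h : ℕ) : IsProbabilityMeasure (M.stateLaw π h) :=
  Measure.isProbabilityMeasure_map (by fun_prop)

lemma stateLaw_zero (π : Policy X A) : M.stateLaw π 0 = Measure.dirac M.init := by
  rw [stateLaw, histLaw, Measure.map_dirac' measurable_snd]

/-- A Markov policy sees the history only through the current state, so the rest of the history
integrates out. -/
lemma occupancy_toPolicy (π : MarkovPolicy X A) (h : ℕ) :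
    M.occupancy π.toPolicy h = M.stateLaw π.toPolicy h ⊗ₘ π.kernel h := by
  ext s hs
  rw [occupancy, Measure.map_apply (by fun_prop) hs, Measure.compProd_apply hs,
    Measure.compProd_apply (hs.preimage (by fun_prop)), stateLaw,
    lintegral_map (Kernel.measurable_kernel_prodMk_left hs) (by fun_prop)]
  rfl

lemma stateLaw_succ (π : Policy X A) (h : ℕ) :
    M.stateLaw π (h + 1) = (M.occupancy π h ⊗ₘ M.P h).map Prod.snd := by
  have h1 := map_stepData_histLaw (M := M) π (Fin.last h)
  have h2 : (Prod.snd ∘ Prod.snd) ∘ stepData (X := X) (A := A) (Fin.last h)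
      = Prod.snd := by
    funext e; simp [stepData, histState]
  rw [stateLaw, ← h2, ← Measure.map_map (by fun_prop) (measurable_stepData _), h1, Fin.val_last]
  ext s hs
  rw [Measure.map_apply (by fun_prop) hs, Measure.map_apply (by fun_prop) hs,
    Measure.compProd_apply (hs.preimage (by fun_prop)),
    Measure.compProd_apply (hs.preimage (by fun_prop))]
  refine lintegral_congr fun z => ?_
  have : Prod.mk z ⁻¹' ((Prod.snd ∘ Prod.snd : (X × A) × (ℝ × X) → X) ⁻¹' s)
      = Set.univ ×ˢ s := by ext; simp
  rw [this, Kernel.prod_apply, Measure.prod_prod]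
  simp
  rfl

lemma value_of_lt (π : MarkovPolicy X A) {h : ℕ} (hh : h < M.H) (x : X) :
    M.value π h x = ∫ a, M.qValue π h x a ∂(π.kernel h x) := by
  rw [value, if_pos hh]
  rfl

lemma value_of_le (π : MarkovPolicy X A) {h : ℕ} (hh : M.H ≤ h) (x : X) :
    M.value π h x = 0 := by
  rw [value, if_neg (not_lt.2 hh)]

namespace RegularClass

variable (hF : M.RegularClass F)
include hF

/-- Backward induction with `n` bounding the number of remaining steps, each adding at most `1`. The
bound is `n` and not `1` because summed rewards are controlled only along reachable trajectories; it
serves integrability alone. -/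
lemma measurable_value_and_abs_le (π : MarkovPolicy X A) (n : ℕ) :
    ∀ h, M.H ≤ h + n → Measurable (M.value π h) ∧ ∀ x, |M.value π h x| ≤ n := by
  induction n with
  | zero =>
    intro h hh
    have : M.value π h = fun _ => 0 := funext fun x => value_of_le π (by omega) x
    rw [this]
    simp
  | succ n ih =>
    intro h hh
    by_cases hlt : h < M.H
    · obtain ⟨hm, hb⟩ := ih (h + 1) (by omega)
      have hq : Measurable fun z : X × A => M.qValue π h z.1 z.2 :=
        (measurable_meanReward h).add
          ((hm.stronglyMeasurable.integral_kernel (κ := M.P h)).measurable)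
      have hqb : ∀ x a, |M.qValue π h x a| ≤ (n + 1 : ℕ) := by
        intro x a
        have h1 := hF.abs_meanReward_le hlt x a
        have h2 : |∫ x', M.value π (h + 1) x' ∂(M.P h (x, a))| ≤ n := by
          rw [← Real.norm_eq_abs]
          exact (norm_integral_le_of_norm_le_const (ae_of_all _ hb)).trans (by simp)
        rw [qValue]
        push_cast
        exact (abs_add_le _ _).trans (by linarith)
      have heq : M.value π h = fun x => ∫ a, M.qValue π h x a ∂(π.kernel h x) :=
        funext (value_of_lt π hlt)
      rw [heq]
      refine ⟨(hq.stronglyMeasurable.integral_kernel_prod_right).measurable, fun x => ?_⟩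
      rw [← Real.norm_eq_abs]
      exact (norm_integral_le_of_norm_le_const (ae_of_all _ (hqb x))).trans (by simp)
    · have : M.value π h = fun _ => 0 := funext fun x => value_of_le π (by omega) x
      rw [this]
      exact ⟨measurable_const, fun x => by simp; positivity⟩

lemma integrable_value (π : MarkovPolicy X A) (h : ℕ) (ν : Measure X) [IsFiniteMeasure ν] :
    Integrable (M.value π h) ν :=
  have := hF.measurable_value_and_abs_le π M.H h (by omega)
  Integrable.of_bound this.1.aestronglyMeasurable _ (ae_of_all _ this.2)

lemma integrable_qValue (π : MarkovPolicy X A) {h : ℕ} (hh : h < M.H) (ν : Measure (X × A))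
    [IsFiniteMeasure ν] : Integrable (fun z : X × A => M.qValue π h z.1 z.2) ν := by
  obtain ⟨hm, hb⟩ := hF.measurable_value_and_abs_le π M.H (h + 1) (by omega)
  refine Integrable.of_bound (C := 1 + M.H) (((measurable_meanReward h).add
    ((hm.stronglyMeasurable.integral_kernel (κ := M.P h)).measurable)).aestronglyMeasurable)
    (ae_of_all _ fun z => ?_)
  have h1 := hF.abs_meanReward_le hh z.1 z.2
  have h2 : |∫ x', M.value π (h + 1) x' ∂(M.P h z)| ≤ M.H := by
    rw [← Real.norm_eq_abs]
    exact (norm_integral_le_of_norm_le_const (ae_of_all _ hb)).trans (by simp)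
  exact (abs_add_le _ _).trans (add_le_add h1 h2)

/-- The expected advantage of `f_h` over `Q_h^π` is the expected Bellman residual plus the expected
gap at the next step between the maximum of `f_{h+1}` and the value of `π`. -/
lemma integral_stateLaw_succ (π : MarkovPolicy X A) {f : QFun X A} (hf : f ∈ Set.univ.pi F)
    {h : ℕ} (hh : h < M.H) :
    ∫ z, f h z.1 z.2 - M.qValue π h z.1 z.2 ∂(M.occupancy π.toPolicy h)
      = ∫ z, M.residual h f z.1 z.2 ∂(M.occupancy π.toPolicy h)
        + ∫ x, (⨆ a, f (h + 1) x a) - M.value π (h + 1) x ∂(M.stateLaw π.toPolicy (h + 1)) := by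
  have hsup := hF.sup_meas (h + 1) _ (hf (h + 1) trivial)
  have hval := (hF.measurable_value_and_abs_le π M.H (h + 1) (by omega)).1
  have hd : Measurable fun x => (⨆ a, f (h + 1) x a) - M.value π (h + 1) x := hsup.sub hval
  have hint : ∀ ν : Measure X, IsFiniteMeasure ν →
      Integrable (fun x => (⨆ a, f (h + 1) x a) - M.value π (h + 1) x) ν := fun ν _ =>
    (hF.integrable_ciSup (hf (h + 1) trivial) ν).sub (hF.integrable_value π (h + 1) ν)
  have hint2 : Integrable (fun p : (X × A) × X => (⨆ a, f (h + 1) p.2 a) - M.value π (h + 1) p.2)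
      (M.occupancy π.toPolicy h ⊗ₘ M.P h) :=
    (integrable_map_measure hd.aestronglyMeasurable (by fun_prop)).1
      (hint ((M.occupancy π.toPolicy h ⊗ₘ M.P h).map Prod.snd)
        (by infer_instance))
  rw [stateLaw_succ, integral_map (by fun_prop) hd.aestronglyMeasurable,
    Measure.integral_compProd hint2, ← integral_add (hF.integrable_residual hh hf _)
      (integrable_integral_of_compProd hint2)]
  refine integral_congr_ae (ae_of_all _ fun z => ?_)
  simp only
  rw [integral_sub (hF.integrable_ciSup (hf (h + 1) trivial) _) (hF.integrable_value π (h + 1) _)]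
  simp only [residual, bellman, qValue]
  ring

lemma integral_occupancy (π : MarkovPolicy X A) {f : QFun X A} (hf : f ∈ Set.univ.pi F)
    {h : ℕ} (hh : h < M.H) :
    ∫ z, f h z.1 z.2 - M.qValue π h z.1 z.2 ∂(M.occupancy π.toPolicy h)
      = ∫ x, (∫ a, f h x a ∂(π.kernel h x)) - M.value π h x ∂(M.stateLaw π.toPolicy h) := by
  have hfi : ∀ (ν : Measure (X × A)), IsFiniteMeasure ν →
      Integrable (fun z : X × A => f h z.1 z.2) ν := fun ν _ =>
    Integrable.of_bound (hF.meas h _ (hf h trivial)).aestronglyMeasurable 1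
      (ae_of_all _ fun z => by
        have := hF.mem01 h _ (hf h trivial) z.1 z.2
        rw [Real.norm_eq_abs, abs_le]; constructor <;> linarith)
  have hq := hF.integrable_qValue π hh (M.stateLaw π.toPolicy h ⊗ₘ π.kernel h)
  have hf' := hfi (M.stateLaw π.toPolicy h ⊗ₘ π.kernel h) inferInstance
  rw [occupancy_toPolicy, integral_sub hf' hq, Measure.integral_compProd hf',
    Measure.integral_compProd hq, ← integral_sub (integrable_integral_of_compProd hf')
      (integrable_integral_of_compProd hq)]
  refine integral_congr_ae (ae_of_all _ fun x => ?_)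
  simp only [value_of_lt π hh]

/-- Telescoping. The only loss at each step is the replacement of the mean of `f_n(x, ·)` under `π`
by its maximum. -/
lemma sum_residual_le (π : MarkovPolicy X A) {f : QFun X A} (hf : f ∈ Set.univ.pi F) (n : ℕ)
    (hn : n ≤ M.H) :
    ∑ h ∈ Finset.range n, ∫ z, M.residual h f z.1 z.2 ∂(M.occupancy π.toPolicy h)
      + ∫ x, (⨆ a, f n x a) - M.value π n x ∂(M.stateLaw π.toPolicy n)
      ≤ (⨆ a, f 0 M.init a) - M.value π 0 M.init := by
  induction n with
  | zero =>
    have hsup := hF.sup_meas 0 _ (hf 0 trivial)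
    have hval := (hF.measurable_value_and_abs_le π M.H 0 (by omega)).1
    have hd : Measurable fun x => (⨆ a, f 0 x a) - M.value π 0 x := hsup.sub hval
    rw [stateLaw_zero, integral_dirac' _ _ hd.stronglyMeasurable]
    simp
  | succ n ih =>
    refine le_trans ?_ (ih (by omega))
    rw [Finset.sum_range_succ, add_assoc, ← hF.integral_stateLaw_succ π hf (by omega),
      hF.integral_occupancy π hf (by omega)]
    gcongr
    · have hfi : Integrable (fun x => ∫ a, f n x a ∂(π.kernel n x)) (M.stateLaw π.toPolicy n) :=
        Integrable.of_bound
          ((hF.meas n _ (hf n trivial)).stronglyMeasurable.integral_kernel_prod_right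
            (κ := π.kernel n)).aestronglyMeasurable 1
          (ae_of_all _ fun x => (norm_integral_le_of_norm_le_const (C := 1) (ae_of_all _ fun a => by
            have := hF.mem01 n _ (hf n trivial) x a
            rw [Real.norm_eq_abs, abs_le]; constructor <;> linarith)).trans (by simp))
      exact hfi.sub (hF.integrable_value π n _)
    · exact (hF.integrable_ciSup (hf n trivial) _).sub (hF.integrable_value π n _)
    · intro x
      have hfi : Integrable (f n x) (π.kernel n x) :=
        Integrable.of_bound ((hF.meas n _ (hf n trivial)).comp
          measurable_prodMk_left).aestronglyMeasurable 1
          (ae_of_all _ fun a => by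
            have := hF.mem01 n _ (hf n trivial) x a
            rw [Real.norm_eq_abs, abs_le]; constructor <;> linarith)
      have : ∫ a, f n x a ∂(π.kernel n x) ≤ ⨆ a, f n x a := by
        refine (integral_mono hfi (integrable_const _)
          fun a => hF.le_ciSup (hf n trivial) x a).trans (by simp)
      simpa using this

/-- The greedy policy attains the maximum, so the telescoping of `sum_residual_le` loses nothing. -/
lemma sum_residual_greedy (π : MarkovPolicy X A) {f : QFun X A} (hf : f ∈ Set.univ.pi F)
    (hπ : M.IsGreedy f π) (n : ℕ) (hn : n ≤ M.H) :
    ∑ h ∈ Finset.range n, ∫ z, M.residual h f z.1 z.2 ∂(M.occupancy π.toPolicy h)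
      + ∫ x, (⨆ a, f n x a) - M.value π n x ∂(M.stateLaw π.toPolicy n)
      = (⨆ a, f 0 M.init a) - M.value π 0 M.init := by
  induction n with
  | zero =>
    have hsup := hF.sup_meas 0 _ (hf 0 trivial)
    have hval := (hF.measurable_value_and_abs_le π M.H 0 (by omega)).1
    have hd : Measurable fun x => (⨆ a, f 0 x a) - M.value π 0 x := hsup.sub hval
    rw [stateLaw_zero, integral_dirac' _ _ hd.stronglyMeasurable]
    simp
  | succ n ih =>
    rw [← ih (by omega), Finset.sum_range_succ, add_assoc,
      ← hF.integral_stateLaw_succ π hf (by omega), hF.integral_occupancy π hf (by omega)]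
    congr 2
    funext x
    rw [hπ.ciSup_eq_integral (by omega) (hF.meas n _ (hf n trivial))]

/-- The loss in value of the greedy policy of `f` against `π'` is controlled by the Bellman
residuals of `f` under both policies. -/
lemma value_sub_value_le (π' πf : MarkovPolicy X A) {f : QFun X A} (hf : f ∈ Set.univ.pi F)
    (hπ : M.IsGreedy f πf) :
    M.value π' 0 M.init - M.value πf 0 M.init
      ≤ ∑ h ∈ Finset.range M.H,
        (|∫ z, M.residual h f z.1 z.2 ∂(M.occupancy π'.toPolicy h)|
          + |∫ z, M.residual h f z.1 z.2 ∂(M.occupancy πf.toPolicy h)|) := by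
  have h1 := hF.sum_residual_le π' hf M.H le_rfl
  have h2 := hF.sum_residual_greedy πf hf hπ M.H le_rfl
  have hz : f M.H = fun _ _ => 0 := by
    have := hf M.H trivial
    rw [hF.zero M.H le_rfl] at this
    exact this
  simp only [hz, value_of_le _ le_rfl] at h1 h2
  simp only [Real.iSup_const_zero, sub_zero, integral_zero, add_zero] at h1 h2
  -- The unknown `max_a f_0` cancels between the inequality for `π'` and the equality for `πf`.
  have h3 : M.value π' 0 M.init - M.value πf 0 M.init
      ≤ ∑ h ∈ Finset.range M.H, (-∫ z, M.residual h f z.1 z.2 ∂(M.occupancy π'.toPolicy h)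
          + ∫ z, M.residual h f z.1 z.2 ∂(M.occupancy πf.toPolicy h)) := by
    rw [Finset.sum_add_distrib, Finset.sum_neg_distrib]
    linarith
  refine h3.trans (Finset.sum_le_sum fun h _ => ?_)
  exact add_le_add (neg_le_abs _) (le_abs_self _)

end RegularClass

end MDP

/-! ### Exponential moments of the excess loss -/

/-- A reward, clipped to the unit interval. -/
def clip (r : ℝ) : ℝ := max 0 (min 1 r)

lemma clip_mem01 (r : ℝ) : 0 ≤ clip r ∧ clip r ≤ 1 :=
  ⟨le_max_left _ _, max_le zero_le_one (min_le_left _ _)⟩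

lemma clip_of_mem01 {r : ℝ} (h0 : 0 ≤ r) (h1 : r ≤ 1) : clip r = r := by
  rw [clip, min_eq_right h1, max_eq_right h0]

lemma measurable_clip : Measurable clip := by unfold clip; fun_prop

lemma exp_neg_le_quadratic {x : ℝ} (hx : |x| ≤ 1) : Real.exp (-x) ≤ 1 - x + x ^ 2 := by
  have := Real.abs_exp_sub_one_sub_id_le (x := -x) (by rwa [abs_neg])
  have := (abs_le.1 this).2
  nlinarith

/-- With `D = a - b`, `|b - y| ≤ 2`, a pointwise bound on the exponential of the excess square loss
`(a - y)² - (b - y)²`. -/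
lemma exp_neg_excess_le {a b y : ℝ} (ha : 0 ≤ a ∧ a ≤ 1) (hb : 0 ≤ b ∧ b ≤ 1)
    (hy : 0 ≤ y ∧ y ≤ 2) :
    Real.exp (-(((a - y) ^ 2 - (b - y) ^ 2) / 50))
      ≤ 1 - (a - b) ^ 2 / 100 - (a - b) / 25 * (b - y) := by
  obtain ⟨ha0, ha1⟩ := ha
  obtain ⟨hb0, hb1⟩ := hb
  obtain ⟨hy0, hy1⟩ := hy
  set s := a + b - 2 * y with hs
  have e1 : (a - y) ^ 2 - (b - y) ^ 2 = (a - b) * s := by rw [hs]; ring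
  have hs2 : s ^ 2 ≤ 16 := by nlinarith
  have hD2 : (a - b) ^ 2 ≤ 1 := by nlinarith
  have hDs : ((a - b) * s) ^ 2 ≤ 16 * (a - b) ^ 2 := by
    rw [mul_pow]; nlinarith [sq_nonneg (a - b)]
  have habs : |((a - b) * s) / 50| ≤ 1 := by
    rw [← sq_le_one_iff_abs_le_one]; nlinarith
  rw [e1]
  refine (exp_neg_le_quadratic habs).trans ?_
  have : (a - b) * s = (a - b) ^ 2 + 2 * (a - b) * (b - y) := by rw [hs]; ring
  -- As `|s| ≤ 4`, the quadratic term is at most `16 (a - b)² / 2500`, below half of the `(a - b)² /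
  -- 50` coming from the linear term. This is why the scale `50` leaves `1/100`.
  have h3 : ((a - b) * s / 50) ^ 2 ≤ (a - b) ^ 2 / 100 := by nlinarith [sq_nonneg (a - b)]
  linarith

namespace MDP

variable {X : Type u} {A : Type v} [MeasurableSpace X] [MeasurableSpace A] {M : MDP X A}
  {F : ℕ → Set (X → A → ℝ)}

/-- The regression target of fitted-Q iteration, with clipped reward. -/
def target (g : X → A → ℝ) (w : ℝ × X) : ℝ := clip w.1 + ⨆ a, g w.2 a

/-- The excess square loss of `f` over the Bellman backup of `g` on one transition. -/
def excess (M : MDP X A) (h : ℕ) (f g : X → A → ℝ) (p : (X × A) × (ℝ × X)) : ℝ :=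
  (f p.1.1 p.1.2 - target g p.2) ^ 2 - (M.bellman h g p.1.1 p.1.2 - target g p.2) ^ 2

/-- Nonnegative rewards with sum at most `1` are each at most `1`; disintegrating the transition law
moves this bound to the conditional reward law. -/
lemma RewardsBounded.ae_reward (hR : M.RewardsBounded) (π : Policy X A) (h : Fin M.H) :
    ∀ᵐ z ∂(M.occupancy π h), ∀ᵐ r ∂(M.R h z), 0 ≤ r ∧ r ≤ 1 := by
  have h1 : ∀ᵐ e ∂(M.histLaw π M.H), 0 ≤ histReward e h ∧ histReward e h ≤ 1 := by
    filter_upwards [hR π] with e he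
    exact ⟨he.1 h, (Finset.single_le_sum (fun i _ => he.1 i) (Finset.mem_univ h)).trans he.2⟩
  have hms : MeasurableSet {p : (X × A) × (ℝ × X) | 0 ≤ p.2.1 ∧ p.2.1 ≤ 1} :=
    (measurableSet_Icc (a := (0 : ℝ)) (b := 1)).preimage
      (f := fun p : (X × A) × (ℝ × X) => p.2.1) (by fun_prop)
  have h2 : ∀ᵐ p ∂(M.histLaw π M.H).map (stepData h), 0 ≤ p.2.1 ∧ p.2.1 ≤ 1 := by
    rw [ae_map_iff (measurable_stepData h).aemeasurable hms]
    exact h1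
  rw [map_stepData_histLaw] at h2
  filter_upwards [Measure.ae_ae_of_ae_compProd h2] with z hz
  rw [Kernel.prod_apply] at hz
  filter_upwards [Measure.ae_ae_of_ae_prod hz] with r hr
  exact hr.exists.choose_spec

namespace RegularClass

variable (hF : M.RegularClass F)
include hF

lemma measurable_target {h : ℕ} {g : X → A → ℝ} (hg : g ∈ F h) : Measurable (target g) :=
  (measurable_clip.comp measurable_fst).add ((hF.sup_meas h g hg).comp measurable_snd)

lemma target_mem {h : ℕ} {g : X → A → ℝ} (hg : g ∈ F h) (w : ℝ × X) :
    0 ≤ target g w ∧ target g w ≤ 2 := by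
  have h1 := clip_mem01 w.1
  have h2 := hF.ciSup_mem01 hg w.2
  rw [target]
  constructor <;> linarith

lemma measurable_excess {h : ℕ} (hh : h < M.H) {f g : X → A → ℝ} (hf : f ∈ F h)
    (hg : g ∈ F (h + 1)) : Measurable (M.excess h f g) := by
  have h1 : Measurable fun p : (X × A) × (ℝ × X) => f p.1.1 p.1.2 :=
    (hF.meas h f hf).comp measurable_fst
  have h2 : Measurable fun p : (X × A) × (ℝ × X) => M.bellman h g p.1.1 p.1.2 :=
    (hF.meas h _ (hF.complete h hh g hg)).comp measurable_fst
  have h3 : Measurable fun p : (X × A) × (ℝ × X) => target g p.2 :=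
    (hF.measurable_target hg).comp measurable_snd
  exact ((h1.sub h3).pow_const 2).sub ((h2.sub h3).pow_const 2)

lemma abs_excess_le {h : ℕ} (hh : h < M.H) {f g : X → A → ℝ} (hf : f ∈ F h)
    (hg : g ∈ F (h + 1)) (p : (X × A) × (ℝ × X)) : |M.excess h f g p| ≤ 4 := by
  have h1 := hF.mem01 h f hf p.1.1 p.1.2
  have h2 := hF.mem01 h _ (hF.complete h hh g hg) p.1.1 p.1.2
  have h3 := hF.target_mem hg p.2
  rw [excess, abs_le]
  constructor <;> nlinarith

/-- Clipping keeps the target bounded everywhere and changes nothing almost surely on visited pairs,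
so the Bellman backup remains its conditional mean. -/
lemma integral_target (hR : M.RewardsBounded) (π : Policy X A) (h : Fin M.H) {g : X → A → ℝ}
    (hg : g ∈ F (h + 1)) :
    ∀ᵐ z ∂(M.occupancy π h),
      ∫ w, target g w ∂((M.R h ×ₖ M.P h) z) = M.bellman h g z.1 z.2 := by
  filter_upwards [hR.ae_reward π h] with z hz
  have hc : Integrable clip (M.R h z) :=
    Integrable.of_bound measurable_clip.aestronglyMeasurable 1 (ae_of_all _ fun r => by
      have := clip_mem01 r
      rw [Real.norm_eq_abs, abs_le]; constructor <;> linarith)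
  have hs := hF.integrable_ciSup hg (M.P h z)
  rw [Kernel.prod_apply]
  simp only [target]
  rw [integral_add (hc.comp_fst _) (hs.comp_snd _),
    integral_fun_fst (μ := M.R h z) (ν := M.P h z) clip,
    integral_fun_snd (μ := M.R h z) (ν := M.P h z) (fun x => ⨆ a, g x a)]
  simp only [probReal_univ, one_smul]
  rw [bellman, meanReward]
  congr 1
  exact integral_congr_ae (hz.mono fun r hr => clip_of_mem01 hr.1 hr.2)

/-- The exponential moment bound for the excess loss of one transition. -/
lemma integral_exp_neg_excess_le (hR : M.RewardsBounded) (π : Policy X A) (h : Fin M.H)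
    {f g : X → A → ℝ} (hf : f ∈ F h) (hg : g ∈ F (h + 1)) :
    ∫ e, Real.exp (-(M.excess h f g (stepData h e) / 50)) ∂(M.histLaw π M.H)
      ≤ Real.exp (-((∫ z, (f z.1 z.2 - M.bellman h g z.1 z.2) ^ 2 ∂(M.occupancy π h)) / 100)) := by
  have hh := h.isLt
  have hB := hF.complete h hh g hg
  have hmX := hF.measurable_excess hh hf hg
  have hmE : Measurable fun p => Real.exp (-(M.excess h f g p / 50)) := by fun_prop
  have hfm : Measurable fun z : X × A => f z.1 z.2 := hF.meas h f hf
  have hbm : Measurable fun z : X × A => M.bellman h g z.1 z.2 := hF.meas h _ hB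
  have htm := hF.measurable_target hg
  set D : X × A → ℝ := fun z => f z.1 z.2 - M.bellman h g z.1 z.2 with hD
  have hDm : Measurable D := hfm.sub hbm
  have hD1 : ∀ z, |D z| ≤ 1 := fun z => by
    have h1 := hF.mem01 h f hf z.1 z.2
    have h2 := hF.mem01 h _ hB z.1 z.2
    rw [hD, abs_le]; constructor <;> simp only <;> linarith
  have hD2 : ∀ z, |D z ^ 2| ≤ 1 := fun z => by
    rw [abs_of_nonneg (sq_nonneg _)]; exact (sq_le_one_iff_abs_le_one _).2 (hD1 z)
  have hiD : Integrable (fun z => D z ^ 2) (M.occupancy π h) :=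
    Integrable.of_bound (hDm.pow_const 2).aestronglyMeasurable 1 (ae_of_all _ hD2)
  -- `G` is the pointwise majorant of `exp_neg_excess_le`. Its last term has conditional mean zero
  -- by `integral_target`, which leaves `1 - D² / 100`.
  set G : (X × A) × (ℝ × X) → ℝ := fun p =>
    1 - D p.1 ^ 2 / 100 - D p.1 / 25 * (M.bellman h g p.1.1 p.1.2 - target g p.2) with hG
  have hGm : Measurable G := by
    have h1 : Measurable fun p : (X × A) × (ℝ × X) => M.bellman h g p.1.1 p.1.2 :=
      hbm.comp measurable_fst
    fun_prop
  have hGi : Integrable G (M.occupancy π h ⊗ₘ (M.R h ×ₖ M.P h)) := by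
    refine Integrable.of_bound hGm.aestronglyMeasurable 3 (ae_of_all _ fun p => ?_)
    have h1 := abs_le.1 (hD1 p.1)
    have h2 := abs_le.1 (hD2 p.1)
    have h3 := hF.mem01 h _ hB p.1.1 p.1.2
    have h4 := hF.target_mem hg p.2
    have h5 : |D p.1 / 25 * (M.bellman h g p.1.1 p.1.2 - target g p.2)| ≤ 1 / 25 * 2 := by
      rw [abs_mul]
      gcongr
      · rw [abs_div, abs_of_pos (by norm_num : (0 : ℝ) < 25)]
        gcongr
        exact hD1 _
      · rw [abs_le]; constructor <;> linarith
    have h6 := abs_le.1 h5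
    rw [hG, Real.norm_eq_abs, abs_le]
    constructor <;> simp only <;> linarith
  calc ∫ e, Real.exp (-(M.excess h f g (stepData h e) / 50)) ∂(M.histLaw π M.H)
      = ∫ p, Real.exp (-(M.excess h f g p / 50)) ∂(M.occupancy π h ⊗ₘ (M.R h ×ₖ M.P h)) := by
        rw [← map_stepData_histLaw,
          integral_map (measurable_stepData h).aemeasurable hmE.aestronglyMeasurable]
    _ ≤ ∫ p, G p ∂(M.occupancy π h ⊗ₘ (M.R h ×ₖ M.P h)) := by
        refine integral_mono_of_nonneg (ae_of_all _ fun p => (Real.exp_pos _).le) hGi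
          (ae_of_all _ fun p => ?_)
        exact exp_neg_excess_le (hF.mem01 h f hf _ _) (hF.mem01 h _ hB _ _) (hF.target_mem hg _)
    _ = ∫ z, (1 - D z ^ 2 / 100) ∂(M.occupancy π h) := by
        rw [Measure.integral_compProd hGi]
        refine integral_congr_ae ?_
        filter_upwards [hF.integral_target hR π h hg] with z hz
        have hti : Integrable (target g) ((M.R h ×ₖ M.P h) z) :=
          Integrable.of_bound htm.aestronglyMeasurable 2 (ae_of_all _ fun w => by
            have := hF.target_mem hg w
            rw [Real.norm_eq_abs, abs_le]; constructor <;> linarith)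
        have hi2 : Integrable (fun w => D z / 25 * (M.bellman h g z.1 z.2 - target g w))
            ((M.R h ×ₖ M.P h) z) := ((integrable_const _).sub hti).const_mul _
        simp only [hG]
        rw [integral_sub (integrable_const _) hi2,
          integral_const_mul, integral_sub (integrable_const _) hti, hz]
        simp
    _ = 1 - (∫ z, D z ^ 2 ∂(M.occupancy π h)) / 100 := by
        rw [integral_sub (integrable_const _) (hiD.div_const _), integral_div]
        simp
    _ ≤ _ := by
        have := Real.add_one_le_exp (-((∫ z, D z ^ 2 ∂(M.occupancy π h)) / 100))
        linarith

end RegularClass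

end MDP

/-! ### Conditional laws and Ville's inequality -/

lemma condExp_comp_simpleFunc {Ω Y : Type*} {m mΩ : MeasurableSpace Ω} [MeasurableSpace Y]
    {μ : Measure Ω} [IsFiniteMeasure μ] {Z : Ω → Y} (hZ : Measurable Z)
    {κ : Ω → Measure Y} (hκ : ∀ ω, IsProbabilityMeasure (κ ω))
    (h : ∀ S : Set Y, MeasurableSet S →
      μ[(Z ⁻¹' S).indicator (fun _ => (1 : ℝ)) | m] =ᵐ[μ] fun ω => (κ ω).real S)
    (s : SimpleFunc Y ℝ) :
    μ[fun ω => s (Z ω) | m] =ᵐ[μ] fun ω => ∫ y, s y ∂(κ ω) := by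
  have hint : ∀ s : SimpleFunc Y ℝ, Integrable (fun ω => s (Z ω)) μ := fun s => by
    obtain ⟨C, hC⟩ := s.exists_forall_norm_le
    exact Integrable.of_bound (s.measurable.comp hZ).aestronglyMeasurable C
      (ae_of_all _ fun ω => hC _)
  induction s using SimpleFunc.induction with
  | const c hS =>
    rename_i S
    have e1 : (fun ω => (SimpleFunc.piecewise S hS (SimpleFunc.const Y c)
        (SimpleFunc.const Y 0)) (Z ω)) = c • (Z ⁻¹' S).indicator (fun _ => (1 : ℝ)) := by
      funext ω
      by_cases hω : Z ω ∈ S <;> simp [SimpleFunc.piecewise_apply, hω]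
    rw [e1]
    filter_upwards [condExp_smul (μ := μ) c ((Z ⁻¹' S).indicator (fun _ => (1 : ℝ))) m, h S hS]
      with ω h1 h2
    rw [h1, Pi.smul_apply, h2]
    have := hκ ω
    have e2 : ∀ y, (SimpleFunc.piecewise S hS (SimpleFunc.const Y c) (SimpleFunc.const Y 0)) y
        = S.indicator (fun _ => c) y := fun y => by
      by_cases hy : y ∈ S <;> simp [SimpleFunc.piecewise_apply, hy]
    simp_rw [e2]
    rw [integral_indicator_const _ hS, smul_eq_mul, smul_eq_mul, mul_comm]
  | add hd hf hg =>
    rename_i f g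
    have e1 : (fun ω => (f + g) (Z ω)) = (fun ω => f (Z ω)) + fun ω => g (Z ω) := rfl
    rw [e1]
    filter_upwards [condExp_add (hint f) (hint g) m, hf, hg] with ω h1 h2 h3
    have := hκ ω
    have hi : ∀ s : SimpleFunc Y ℝ, Integrable s (κ ω) := fun s => by
      obtain ⟨C, hC⟩ := s.exists_forall_norm_le
      exact Integrable.of_bound s.measurable.aestronglyMeasurable C (ae_of_all _ hC)
    rw [h1, Pi.add_apply, h2, h3, ← integral_add (hi f) (hi g)]
    rfl

/-- A conditional law, given on events, determines the conditional expectations of bounded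
functions. -/
lemma condExp_comp_of_condLaw {Ω Y : Type*} {m mΩ : MeasurableSpace Ω} [MeasurableSpace Y]
    {μ : Measure Ω} [IsFiniteMeasure μ] (hm : m ≤ mΩ) {Z : Ω → Y} (hZ : Measurable Z)
    {κ : Ω → Measure Y} (hκ : ∀ ω, IsProbabilityMeasure (κ ω))
    (h : ∀ S : Set Y, MeasurableSet S →
      μ[(Z ⁻¹' S).indicator (fun _ => (1 : ℝ)) | m] =ᵐ[μ] fun ω => (κ ω).real S)
    {φ : Y → ℝ} (hφ : Measurable φ) {C : ℝ} (hC : ∀ y, |φ y| ≤ C) :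
    μ[fun ω => φ (Z ω) | m] =ᵐ[μ] fun ω => ∫ y, φ y ∂(κ ω) := by
  rcases isEmpty_or_nonempty Y with hY | ⟨⟨y0⟩⟩
  · have : IsEmpty Ω := ⟨fun ω => hY.false (Z ω)⟩
    exact ae_of_all _ fun ω => (this.false ω).elim
  have hC0 : 0 ≤ C := (abs_nonneg _).trans (hC y0)
  set s := hφ.stronglyMeasurable.approxBounded C with hs
  have hsb : ∀ n y, ‖s n y‖ ≤ C := fun n y =>
    hφ.stronglyMeasurable.norm_approxBounded_le hC0 n y
  have hst : ∀ y, Filter.Tendsto (fun n => s n y) Filter.atTop (nhds (φ y)) := fun y =>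
    hφ.stronglyMeasurable.tendsto_approxBounded_of_norm_le (hC y)
  have hsimple := fun n => condExp_comp_simpleFunc hZ hκ h (s n)
  have hlim : ∀ ω, Filter.Tendsto (fun n => ∫ y, s n y ∂(κ ω)) Filter.atTop
      (nhds (∫ y, φ y ∂(κ ω))) := fun ω => by
    have := hκ ω
    exact tendsto_integral_of_dominated_convergence (fun _ => C)
      (fun n => (s n).measurable.aestronglyMeasurable) (integrable_const C)
      (fun n => ae_of_all _ (hsb n)) (ae_of_all _ hst)
  -- No measurability of `κ` in `ω` is assumed. The integral is a.e. a limsup of conditional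
  -- expectations, which are `m`-measurable.
  have hg : AEStronglyMeasurable[m] (fun ω => ∫ y, φ y ∂(κ ω)) μ := by
    refine ⟨fun ω => Filter.limsup (fun n => μ[fun ω => s n (Z ω) | m] ω) Filter.atTop,
      (Measurable.limsup fun n => stronglyMeasurable_condExp.measurable).stronglyMeasurable, ?_⟩
    filter_upwards [ae_all_iff.2 hsimple] with ω hω
    simp_rw [hω]
    exact (hlim ω).limsup_eq.symm
  have hgi : Integrable (fun ω => ∫ y, φ y ∂(κ ω)) μ :=
    Integrable.of_bound (hg.mono hm) C (ae_of_all _ fun ω => by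
      have := hκ ω
      exact (norm_integral_le_of_norm_le_const (ae_of_all _ hC)).trans (by simp))
  refine (tendsto_condExp_unique (fun n ω => s n (Z ω)) (fun n ω => ∫ y, s n y ∂(κ ω)) _ _
    (fun n => Integrable.of_bound ((s n).measurable.comp hZ).aestronglyMeasurable C
      (ae_of_all _ fun ω => hsb n _))
    (fun n => integrable_condExp.congr (hsimple n)) (ae_of_all _ fun ω => hst _)
    (ae_of_all _ hlim) (fun _ => C) (integrable_const C) (fun _ => C) (integrable_const C)
    (fun n => ae_of_all _ fun ω => hsb n _) (fun n => ae_of_all _ fun ω => ?_)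
    (fun n => ?_)).trans (condExp_of_aestronglyMeasurable' hm hg hgi)
  · have := hκ ω
    exact (norm_integral_le_of_norm_le_const (ae_of_all _ (hsb n))).trans (by simp)
  · exact (condExp_condExp_of_le le_rfl hm).symm.trans (condExp_congr_ae (hsimple n))

/-- The partial sums of `ζ`, stopped when they reach `L`. -/
def stoppedSum {Ω : Type*} (ζ : ℕ → Ω → ℝ) (L : ℝ) : ℕ → Ω → ℝ
  | 0, _ => 0
  | t + 1, ω => if L ≤ stoppedSum ζ L t ω then stoppedSum ζ L t ω else stoppedSum ζ L t ω + ζ t ω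

lemma le_stoppedSum {Ω : Type*} (ζ : ℕ → Ω → ℝ) (L : ℝ) {t T : ℕ} (htT : t ≤ T) (ω : Ω)
    (h : L ≤ ∑ s ∈ Finset.range t, ζ s ω) : L ≤ stoppedSum ζ L T ω := by
  have h1 : ∀ t, L ≤ stoppedSum ζ L t ω ∨ stoppedSum ζ L t ω = ∑ s ∈ Finset.range t, ζ s ω := by
    intro t
    induction t with
    | zero => right; simp [stoppedSum]
    | succ t ih =>
      rw [stoppedSum]
      split_ifs with hL
      · exact Or.inl hL
      · right
        rw [Finset.sum_range_succ, ih.resolve_left hL]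
  have h2 : L ≤ stoppedSum ζ L t ω := by
    rcases h1 t with h' | h'
    · exact h'
    · rwa [h']
  induction T, htT using Nat.le_induction with
  | base => exact h2
  | succ n _ ih => rw [stoppedSum, if_pos ih]; exact ih

/-- Ville's inequality for exponential supermartingales, over a finite horizon. -/
lemma measure_exists_sum_ge_le {Ω : Type*} [mΩ : MeasurableSpace Ω] {μ : Measure Ω}
    [IsProbabilityMeasure μ] (ℱ : Filtration ℕ mΩ) {ξ η : ℕ → Ω → ℝ}
    (hξ : ∀ t, Measurable[ℱ (t + 1)] (ξ t)) (hη : ∀ t, Measurable[ℱ t] (η t)) {C : ℝ}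
    (hξC : ∀ t ω, |ξ t ω| ≤ C) (hηC : ∀ t, ∀ᵐ ω ∂μ, |η t ω| ≤ C)
    (hle : ∀ t, μ[fun ω => Real.exp (ξ t ω) | ℱ t] ≤ᵐ[μ] fun ω => Real.exp (η t ω))
    (L : ℝ) (T : ℕ) :
    μ {ω | ∃ t ≤ T, L ≤ ∑ s ∈ Finset.range t, (ξ s ω - η s ω)} ≤ ENNReal.ofReal (Real.exp (-L)) := by
  -- Since the sum freezes once it reaches `L`, Markov's inequality at the single time `T` covers
  -- all `t ≤ T`.
  set S := stoppedSum (fun t ω => ξ t ω - η t ω) L with hS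
  have hSm : ∀ t, Measurable[ℱ t] (S t) := by
    intro t
    induction t with
    | zero => exact measurable_const
    | succ t ih =>
      have ih' : Measurable[ℱ (t + 1)] (S t) := ih.mono (ℱ.mono t.le_succ) le_rfl
      have hη' : Measurable[ℱ (t + 1)] (η t) := (hη t).mono (ℱ.mono t.le_succ) le_rfl
      exact Measurable.ite (measurableSet_le measurable_const ih') ih'
        (ih'.add ((hξ t).sub hη'))
  have hSb : ∀ t, ∀ᵐ ω ∂μ, |S t ω| ≤ 2 * C * t := by
    intro t
    induction t with
    | zero => exact ae_of_all _ fun ω => by simp [hS, stoppedSum]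
    | succ t ih =>
      filter_upwards [ih, hηC t] with ω h1 h2
      have h3 := hξC t ω
      have hC := (abs_nonneg _).trans h3
      have e : S (t + 1) ω = if L ≤ S t ω then S t ω else S t ω + (ξ t ω - η t ω) := rfl
      rw [abs_le] at *
      push_cast
      rw [e]
      split_ifs <;> constructor <;> linarith
  have hSm' : ∀ t, Measurable (S t) := fun t => (hSm t).mono (ℱ.le t) le_rfl
  have hSi : ∀ t, Integrable (fun ω => Real.exp (S t ω)) μ := fun t =>
    Integrable.of_bound (hSm' t).exp.aestronglyMeasurable (Real.exp (2 * C * t)) (by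
      filter_upwards [hSb t] with ω h1
      rw [Real.norm_eq_abs, Real.abs_exp, Real.exp_le_exp]
      exact (le_abs_self _).trans h1)
  have hstep : ∀ t, ∫ ω, Real.exp (S (t + 1) ω) ∂μ ≤ ∫ ω, Real.exp (S t ω) ∂μ := by
    intro t
    -- One step reads `exp S_{t+1} = a exp ξ_t + b`, with `b` the stopped part. The factor `a` is `ℱ
    -- t`-measurable and so can be pulled out of the conditional expectation.
    set a : Ω → ℝ := fun ω => if L ≤ S t ω then 0 else Real.exp (S t ω - η t ω) with ha
    set b : Ω → ℝ := fun ω => if L ≤ S t ω then Real.exp (S t ω) else 0 with hb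
    have ham : Measurable[ℱ t] a :=
      Measurable.ite (measurableSet_le measurable_const (hSm t)) measurable_const
        (((hSm t).sub (hη t)).exp)
    have ham' : Measurable a := ham.mono (ℱ.le t) le_rfl
    have hbm : Measurable b :=
      Measurable.ite (measurableSet_le measurable_const (hSm' t)) (hSm' t).exp measurable_const
    have ha0 : ∀ ω, 0 ≤ a ω := fun ω => by
      simp only [ha]; split_ifs
      · exact le_rfl
      · exact (Real.exp_pos _).le
    have hab : ∀ᵐ ω ∂μ, ‖a ω‖ ≤ Real.exp (2 * C * t + C) := by
      filter_upwards [hSb t, hηC t] with ω h1 h2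
      rw [Real.norm_eq_abs, abs_of_nonneg (ha0 ω)]
      simp only [ha]
      split_ifs
      · exact (Real.exp_pos _).le
      · rw [Real.exp_le_exp]
        linarith [(abs_le.1 h1).2, (abs_le.1 h2).1]
    have hbi : Integrable b μ := by
      refine (hSi t).mono hbm.aestronglyMeasurable (ae_of_all _ fun ω => ?_)
      simp only [hb]
      split_ifs <;> simp [Real.abs_exp, (Real.exp_pos _).le]
    have hξi : Integrable (fun ω => Real.exp (ξ t ω)) μ :=
      Integrable.of_bound (((hξ t).mono (ℱ.le _) le_rfl).exp).aestronglyMeasurable (Real.exp C)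
        (ae_of_all _ fun ω => by
          rw [Real.norm_eq_abs, Real.abs_exp, Real.exp_le_exp]
          exact (le_abs_self _).trans (hξC t ω))
    have haξ : Integrable (fun ω => a ω * Real.exp (ξ t ω)) μ :=
      hξi.bdd_mul ham'.aestronglyMeasurable hab
    have hηi : Integrable (fun ω => a ω * Real.exp (η t ω)) μ := by
      refine (hSi t).mono (ham'.mul ((hη t).mono (ℱ.le t) le_rfl).exp).aestronglyMeasurable
        (ae_of_all _ fun ω => ?_)
      simp only [ha]
      split_ifs
      · simp [(Real.exp_pos _).le]
      · rw [← Real.exp_add]; simp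
    have hpull : μ[fun ω => a ω * Real.exp (ξ t ω) | ℱ t]
        =ᵐ[μ] fun ω => a ω * μ[fun ω => Real.exp (ξ t ω) | ℱ t] ω :=
      condExp_mul_of_stronglyMeasurable_left ham.stronglyMeasurable haξ hξi
    have hmain : ∫ ω, a ω * Real.exp (ξ t ω) ∂μ ≤ ∫ ω, a ω * Real.exp (η t ω) ∂μ := by
      rw [← integral_condExp (ℱ.le t)]
      refine integral_mono_ae integrable_condExp hηi ?_
      filter_upwards [hpull, hle t] with ω h1 h2
      rw [h1]
      exact mul_le_mul_of_nonneg_left h2 (ha0 ω)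
    calc ∫ ω, Real.exp (S (t + 1) ω) ∂μ
        = ∫ ω, (a ω * Real.exp (ξ t ω) + b ω) ∂μ := by
          refine integral_congr_ae (ae_of_all _ fun ω => ?_)
          have e : S (t + 1) ω = if L ≤ S t ω then S t ω else S t ω + (ξ t ω - η t ω) := rfl
          simp only [ha, hb, e]
          split_ifs
          · simp
          · rw [add_zero, ← Real.exp_add]; congr 1; ring
      _ = (∫ ω, a ω * Real.exp (ξ t ω) ∂μ) + ∫ ω, b ω ∂μ := integral_add haξ hbi
      _ ≤ (∫ ω, a ω * Real.exp (η t ω) ∂μ) + ∫ ω, b ω ∂μ := by gcongr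
      _ = ∫ ω, (a ω * Real.exp (η t ω) + b ω) ∂μ := (integral_add hηi hbi).symm
      _ = ∫ ω, Real.exp (S t ω) ∂μ := by
          refine integral_congr_ae (ae_of_all _ fun ω => ?_)
          simp only [ha, hb]
          split_ifs
          · simp
          · rw [add_zero, ← Real.exp_add]; congr 1; ring
  have hle1 : ∀ t, ∫ ω, Real.exp (S t ω) ∂μ ≤ 1 := by
    intro t
    induction t with
    | zero => simp [hS, stoppedSum]
    | succ t ih => exact (hstep t).trans ih
  have hmarkov := mul_meas_ge_le_integral_of_nonneg
    (ae_of_all μ fun ω => (Real.exp_pos (S T ω)).le) (hSi T) (Real.exp L)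
  have hreal : μ.real {ω | Real.exp L ≤ Real.exp (S T ω)} ≤ Real.exp (-L) := by
    rw [Real.exp_neg, ← one_div, le_div_iff₀' (Real.exp_pos L)]
    exact hmarkov.trans (hle1 T)
  calc μ {ω | ∃ t ≤ T, L ≤ ∑ s ∈ Finset.range t, (ξ s ω - η s ω)}
      ≤ μ {ω | Real.exp L ≤ Real.exp (S T ω)} := by
        refine measure_mono ?_
        rintro ω ⟨t, htT, ht⟩
        exact Real.exp_le_exp.2 (le_stoppedSum _ L htT ω ht)
    _ = ENNReal.ofReal (μ.real {ω | Real.exp L ≤ Real.exp (S T ω)}) := by simp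
    _ ≤ _ := ENNReal.ofReal_le_ofReal hreal

/-! ### Uniform concentration over a cover -/

/-- The excess is `(a - b)(a + b - 2y)`. The product rule for differences gives `2l · 4 + 1 · 4l =
12l`. -/
lemma abs_excess_sub_excess_le {a b y a' b' y' l : ℝ} (ha : 0 ≤ a ∧ a ≤ 1) (hb : 0 ≤ b ∧ b ≤ 1)
    (hy : 0 ≤ y ∧ y ≤ 2) (ha' : 0 ≤ a' ∧ a' ≤ 1) (hb' : 0 ≤ b' ∧ b' ≤ 1)
    (haa : |a - a'| ≤ l) (hbb : |b - b'| ≤ l) (hyy : |y - y'| ≤ l) :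
    |((a - y) ^ 2 - (b - y) ^ 2) - ((a' - y') ^ 2 - (b' - y') ^ 2)| ≤ 12 * l := by
  have e : ((a - y) ^ 2 - (b - y) ^ 2) - ((a' - y') ^ 2 - (b' - y') ^ 2)
      = ((a - a') - (b - b')) * (a + b - 2 * y)
        + (a' - b') * ((a - a') + (b - b') - 2 * (y - y')) := by ring
  have hl : 0 ≤ l := (abs_nonneg _).trans haa
  rw [abs_le] at haa hbb hyy
  have h1 : |(a - a') - (b - b')| ≤ 2 * l := by rw [abs_le]; constructor <;> linarith
  have h2 : |a + b - 2 * y| ≤ 4 := by rw [abs_le]; constructor <;> linarith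
  have h3 : |a' - b'| ≤ 1 := by rw [abs_le]; constructor <;> linarith
  have h4 : |(a - a') + (b - b') - 2 * (y - y')| ≤ 4 * l := by
    rw [abs_le]; constructor <;> linarith
  rw [e]
  refine (abs_add_le _ _).trans ?_
  rw [abs_mul, abs_mul]
  have h5 := mul_le_mul h1 h2 (abs_nonneg _) (by linarith)
  have h6 := mul_le_mul h3 h4 (abs_nonneg _) (by linarith)
  linarith

lemma sq_sub_sq_le {a b a' b' l : ℝ} (ha : 0 ≤ a ∧ a ≤ 1) (hb : 0 ≤ b ∧ b ≤ 1)
    (ha' : 0 ≤ a' ∧ a' ≤ 1) (hb' : 0 ≤ b' ∧ b' ≤ 1)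
    (haa : |a - a'| ≤ l) (hbb : |b - b'| ≤ l) :
    (a - b) ^ 2 ≤ (a' - b') ^ 2 + 4 * l := by
  have e : (a - b) ^ 2 - (a' - b') ^ 2
      = ((a - a') - (b - b')) * ((a - b) + (a' - b')) := by ring
  have hl : 0 ≤ l := (abs_nonneg _).trans haa
  rw [abs_le] at haa hbb
  have h1 : |(a - a') - (b - b')| ≤ 2 * l := by rw [abs_le]; constructor <;> linarith
  have h2 : |(a - b) + (a' - b')| ≤ 2 := by rw [abs_le]; constructor <;> linarith
  have h5 := mul_le_mul h1 h2 (abs_nonneg _) (by linarith)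
  rw [← abs_mul, ← e] at h5
  linarith [le_abs_self ((a - b) ^ 2 - (a' - b') ^ 2)]

namespace MDP

variable {X : Type u} {A : Type v} {Ω : Type w} [MeasurableSpace X] [MeasurableSpace A]
  [mΩ : MeasurableSpace Ω] {M : MDP X A} {F : ℕ → Set (X → A → ℝ)}
  {expl : QFun X A → Policy X A} {μ : Measure Ω} {ℱ : Filtration ℕ mΩ}
  {episode : ℕ → Ω → Hist X A M.H} {fhat : ℕ → Ω → QFun X A}

/-- The mean square of `f - 𝒯_h g` at step `h` under `π`. -/
def sqGap (M : MDP X A) (π : Policy X A) (h : ℕ) (f g : X → A → ℝ) : ℝ :=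
  ∫ z, (f z.1 z.2 - M.bellman h g z.1 z.2) ^ 2 ∂(M.occupancy π h)

/-- A reward outside `[0, 1]` has probability zero under every policy, hence zero conditional
probability in every episode of the run. -/
lemma IsRun.ae_reward [IsProbabilityMeasure μ] (hrun : M.IsRun F expl μ ℱ episode fhat)
    (hR : M.RewardsBounded) :
    ∀ᵐ ω ∂μ, ∀ s, ∀ h : Fin M.H,
      0 ≤ histReward (episode s ω) h ∧ histReward (episode s ω) h ≤ 1 := by
  rw [ae_all_iff]
  intro s
  rw [ae_all_iff]
  intro h
  have hrm : Measurable fun e : Hist X A M.H => histReward e h := by unfold histReward; fun_prop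
  set S : Set (Hist X A M.H) := {e | 0 ≤ histReward e h ∧ histReward e h ≤ 1}ᶜ with hS
  have hSm : MeasurableSet S := ((measurableSet_Icc (a := (0 : ℝ)) (b := 1)).preimage hrm).compl
  have hem : Measurable (episode s) := (hrun.adapted s).mono (ℱ.le _) le_rfl
  have hzero : ∀ π : Policy X A, M.histLaw π M.H S = 0 := by
    intro π
    have : ∀ᵐ e ∂(M.histLaw π M.H), 0 ≤ histReward e h ∧ histReward e h ≤ 1 := by
      filter_upwards [hR π] with e he
      exact ⟨he.1 h, (Finset.single_le_sum (fun i _ => he.1 i) (Finset.mem_univ h)).trans he.2⟩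
    exact this
  have h1 : ∫ ω, (episode s ⁻¹' S).indicator (fun _ => (1 : ℝ)) ω ∂μ = 0 := by
    rw [← integral_condExp (ℱ.le s), integral_congr_ae (hrun.sample s S hSm)]
    simp [Measure.real, hzero]
  rw [integral_indicator_const _ (hem hSm), smul_eq_mul, mul_one, measureReal_eq_zero_iff] at h1
  exact h1

/-- By completeness the Bellman backup of `fhat_{h+1}` lies in `F h`, so it is a competitor in the
least-squares problem that `fhat_h` solves. -/
lemma IsRun.sum_excess_nonpos [IsProbabilityMeasure μ] (hrun : M.IsRun F expl μ ℱ episode fhat)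
    (hF : M.RegularClass F) (hR : M.RewardsBounded) :
    ∀ᵐ ω ∂μ, ∀ t, fhat t ω ∈ Set.univ.pi F ∧ ∀ h : Fin M.H,
      ∑ s ∈ Finset.range t, M.excess h (fhat t ω h) (fhat t ω (h + 1))
        (stepData h (episode s ω)) ≤ 0 := by
  filter_upwards [hrun.ae_reward hR, ae_all_iff.2 hrun.fit] with ω hr hfit t
  refine ⟨(hfit t).1, fun h => ?_⟩
  have h1 := (hfit t).2 h _ (hF.complete h h.isLt _ ((hfit t).1 (h + 1) trivial))
  rw [loss, loss, ← sub_nonpos, ← Finset.sum_sub_distrib] at h1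
  rw [Finset.sum_range]
  refine le_of_eq_of_le (Finset.sum_congr rfl fun s _ => ?_) h1
  rw [excess]
  simp only [stepData, target, clip_of_mem01 (hr s h).1 (hr s h).2]
  ring

namespace RegularClass

variable (hF : M.RegularClass F)
include hF

lemma measurable_sub_bellman {h : ℕ} (hh : h < M.H) {f g : X → A → ℝ} (hf : f ∈ F h)
    (hg : g ∈ F (h + 1)) :
    Measurable fun z : X × A => (f z.1 z.2 - M.bellman h g z.1 z.2) ^ 2 :=
  ((hF.meas h f hf).sub (hF.meas h _ (hF.complete h hh g hg))).pow_const 2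

lemma sq_sub_bellman_le {h : ℕ} (hh : h < M.H) {f g : X → A → ℝ} (hf : f ∈ F h)
    (hg : g ∈ F (h + 1)) (z : X × A) :
    |(f z.1 z.2 - M.bellman h g z.1 z.2) ^ 2| ≤ 1 := by
  have h1 := hF.mem01 h f hf z.1 z.2
  have h2 := hF.mem01 h _ (hF.complete h hh g hg) z.1 z.2
  rw [abs_of_nonneg (sq_nonneg _)]
  nlinarith

lemma integrable_sq_sub_bellman {h : ℕ} (hh : h < M.H) {f g : X → A → ℝ} (hf : f ∈ F h)
    (hg : g ∈ F (h + 1)) (ν : Measure (X × A)) [IsFiniteMeasure ν] :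
    Integrable (fun z : X × A => (f z.1 z.2 - M.bellman h g z.1 z.2) ^ 2) ν :=
  Integrable.of_bound (hF.measurable_sub_bellman hh hf hg).aestronglyMeasurable 1
    (ae_of_all _ (hF.sq_sub_bellman_le hh hf hg))

lemma abs_sqGap_le {h : ℕ} (hh : h < M.H) {f g : X → A → ℝ} (hf : f ∈ F h)
    (hg : g ∈ F (h + 1)) (π : Policy X A) : |M.sqGap π h f g| ≤ 1 := by
  rw [← Real.norm_eq_abs, sqGap]
  exact (norm_integral_le_of_norm_le_const (ae_of_all _ (hF.sq_sub_bellman_le hh hf hg))).trans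
    (by simp)

lemma integral_histLaw_sq {h : Fin M.H} {f g : X → A → ℝ} (hf : f ∈ F h)
    (hg : g ∈ F (h + 1)) (π : Policy X A) :
    ∫ e, (f (stepData h e).1.1 (stepData h e).1.2
        - M.bellman h g (stepData h e).1.1 (stepData h e).1.2) ^ 2 ∂(M.histLaw π M.H)
      = M.sqGap π h f g := by
  have h1 := hF.measurable_sub_bellman h.isLt hf hg
  have h2 : (M.histLaw π M.H).map (fun e => (stepData h e).1) = M.occupancy π h := by
    have : (fun e : Hist X A M.H => (stepData h e).1) = Prod.fst ∘ stepData h := rfl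
    rw [this, ← Measure.map_map measurable_fst (measurable_stepData h), map_stepData_histLaw]
    exact Measure.fst_compProd _ _
  rw [sqGap, ← h2, integral_map (measurable_stepData h).fst.aemeasurable h1.aestronglyMeasurable]

/-- Uniformly in time, the expected squared Bellman errors of a fixed pair are dominated by the
excess losses. -/
lemma measure_sqGap_gt_le [IsProbabilityMeasure μ] (hrun : M.IsRun F expl μ ℱ episode fhat)
    (hR : M.RewardsBounded) (h : Fin M.H) {f g : X → A → ℝ} (hf : f ∈ F h) (hg : g ∈ F (h + 1))
    (L : ℝ) (T : ℕ) :
    μ {ω | ∃ t ≤ T, L + ∑ s ∈ Finset.range t, M.excess h f g (stepData h (episode s ω)) / 50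
        ≤ ∑ s ∈ Finset.range t, M.sqGap (expl (fhat s ω)) h f g / 100}
      ≤ ENNReal.ofReal (Real.exp (-L)) := by
  have hem : ∀ s, Measurable[ℱ (s + 1)] (episode s) := hrun.adapted
  have hem' : ∀ s, Measurable (episode s) := fun s => (hem s).mono (ℱ.le _) le_rfl
  have hX := hF.measurable_excess h.isLt hf hg
  have hXs : Measurable fun e : Hist X A M.H => M.excess h f g (stepData h e) :=
    hX.comp (measurable_stepData h)
  set φ : Hist X A M.H → ℝ := fun e => (f (stepData h e).1.1 (stepData h e).1.2
        - M.bellman h g (stepData h e).1.1 (stepData h e).1.2) ^ 2 with hφ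
  have hφm : Measurable φ :=
    (hF.measurable_sub_bellman h.isLt hf hg).comp (measurable_stepData h).fst
  -- The errors `sqGap (expl (fhat s ω))` need not be measurable in `ω`. This conditional
  -- expectation is an `ℱ s`-measurable version and plays the role of `η` below.
  have hcφ : ∀ s, μ[fun ω => φ (episode s ω) | ℱ s]
      =ᵐ[μ] fun ω => M.sqGap (expl (fhat s ω)) h f g := fun s => by
    refine (condExp_comp_of_condLaw (ℱ.le s) (hem' s) (fun ω => inferInstance) (hrun.sample s)
      hφm (C := 1) (fun e => hF.sq_sub_bellman_le h.isLt hf hg _)).trans (ae_of_all _ fun ω => ?_)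
    exact hF.integral_histLaw_sq hf hg _
  have hcX : ∀ s, μ[fun ω => Real.exp (-(M.excess h f g (stepData h (episode s ω)) / 50)) | ℱ s]
      =ᵐ[μ] fun ω => ∫ e, Real.exp (-(M.excess h f g (stepData h e) / 50))
        ∂(M.histLaw (expl (fhat s ω)) M.H) := fun s =>
    condExp_comp_of_condLaw (ℱ.le s) (hem' s) (fun ω => inferInstance) (hrun.sample s)
      (φ := fun e => Real.exp (-(M.excess h f g (stepData h e) / 50)))
      (hXs.div_const 50).neg.exp (C := Real.exp 1) (fun e => by
        rw [Real.abs_exp, Real.exp_le_exp]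
        have := abs_le.1 (hF.abs_excess_le h.isLt hf hg (stepData h e))
        linarith)
  have hville := measure_exists_sum_ge_le (μ := μ) ℱ
    (ξ := fun s ω => -(M.excess h f g (stepData h (episode s ω)) / 50))
    (η := fun s ω => -(μ[fun ω => φ (episode s ω) | ℱ s] ω / 100))
    (fun s => ((hXs.comp (hem s)).div_const 50).neg)
    (fun s => (stronglyMeasurable_condExp.measurable.div_const 100).neg) (C := 1)
    (fun s ω => by
      have := abs_le.1 (hF.abs_excess_le h.isLt hf hg (stepData h (episode s ω)))
      rw [abs_le]; constructor <;> linarith)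
    (fun s => by
      filter_upwards [hcφ s] with ω hω
      have := abs_le.1 (hF.abs_sqGap_le h.isLt hf hg (expl (fhat s ω)))
      rw [hω, abs_le]; constructor <;> linarith)
    (fun s => by
      filter_upwards [hcφ s, hcX s] with ω h1 h2
      rw [h1, h2]
      exact hF.integral_exp_neg_excess_le hR _ h hf hg) L T
  refine le_trans (measure_mono_ae ?_) hville
  filter_upwards [ae_all_iff.2 hcφ] with ω hω
  rintro ⟨t, htT, ht⟩
  refine ⟨t, htT, ?_⟩
  simp only [hω]
  rw [Finset.sum_sub_distrib, Finset.sum_neg_distrib, Finset.sum_neg_distrib]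
  linarith

/-- With high probability, all estimates of the run have small squared Bellman errors under the past
exploration policies. -/
lemma measure_sqError_le [IsProbabilityMeasure μ] (hrun : M.IsRun F expl μ ℱ episode fhat)
    (hR : M.RewardsBounded) {T : ℕ} (hT : 0 < T) (Z : ℕ → Finset (X → A → ℝ))
    (hZ : ∀ h, ∀ f ∈ Z h, f ∈ F h)
    (hcov : ∀ h, ∀ f ∈ F h, ∃ f' ∈ Z h, ∀ x a, |f x a - f' x a| ≤ 1 / (T : ℝ))
    (hZH : (Z M.H).card ≤ 1) (L : ℝ) :
    μ {ω | ¬ ∀ t < T, fhat t ω ∈ Set.univ.pi F ∧ ∀ h < M.H,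
        ∑ s ∈ Finset.range t, M.sqError (expl (fhat s ω)) h (fhat t ω) ≤ 28 + 100 * L}
      ≤ ENNReal.ofReal ((∑ h : Fin M.H, ((Z h).card : ℝ)) ^ 2 * Real.exp (-L)) := by
  -- The estimates depend on the data, so concentration is applied to fixed pairs of cover centers
  -- and transferred to them at distance `1/T`.
  set bad : Fin M.H → (X → A → ℝ) → (X → A → ℝ) → Set Ω := fun h f g =>
    {ω | ∃ t ≤ T, L + ∑ s ∈ Finset.range t, M.excess h f g (stepData h (episode s ω)) / 50
        ≤ ∑ s ∈ Finset.range t, M.sqGap (expl (fhat s ω)) h f g / 100} with hbad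
  have hT' : (0 : ℝ) < T := by exact_mod_cast hT
  have hsub : {ω | ¬ ∀ t < T, fhat t ω ∈ Set.univ.pi F ∧ ∀ h < M.H,
        ∑ s ∈ Finset.range t, M.sqError (expl (fhat s ω)) h (fhat t ω) ≤ 28 + 100 * L}
      ≤ᵐ[μ] (⋃ h : Fin M.H, ⋃ f ∈ Z h, ⋃ g ∈ Z (h + 1), bad h f g : Set Ω) := by
    filter_upwards [hrun.sum_excess_nonpos hF hR] with ω hω
    intro hneg
    by_contra hgood
    apply hneg
    intro t ht
    refine ⟨(hω t).1, fun h hh => ?_⟩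
    have hf := (hω t).1 h trivial
    have hg := (hω t).1 (h + 1) trivial
    have hex := (hω t).2 ⟨h, hh⟩
    set f := fhat t ω h with hfdef
    set g := fhat t ω (h + 1) with hgdef
    obtain ⟨f', hf'Z, hff'⟩ := hcov h f hf
    obtain ⟨g', hg'Z, hgg'⟩ := hcov (h + 1) g hg
    have hf' := hZ h f' hf'Z
    have hg' := hZ (h + 1) g' hg'Z
    have hnb : ω ∉ bad ⟨h, hh⟩ f' g' := by
      intro hb
      apply hgood
      exact Set.mem_iUnion.2 ⟨⟨h, hh⟩, Set.mem_iUnion₂.2 ⟨f', hf'Z,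
        Set.mem_iUnion₂.2 ⟨g', hg'Z, hb⟩⟩⟩
    simp only [hbad, Set.mem_ofPred_eq, not_exists, not_and, not_le] at hnb
    have h1 := hnb t ht.le
    have hbb := hF.abs_bellman_sub_le hg hg' hgg' h
    have hB := hF.complete h hh g hg
    have hB' := hF.complete h hh g' hg'
    have h2 : ∀ p : (X × A) × (ℝ × X),
        M.excess h f' g' p ≤ M.excess h f g p + 12 * (1 / (T : ℝ)) := by
      intro p
      have := (abs_le.1 (abs_excess_sub_excess_le (hF.mem01 h f hf p.1.1 p.1.2)
        (hF.mem01 h _ hB p.1.1 p.1.2) (hF.target_mem hg p.2) (hF.mem01 h f' hf' p.1.1 p.1.2)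
        (hF.mem01 h _ hB' p.1.1 p.1.2) (y' := target g' p.2) (hff' _ _) (hbb _ _) (by
          rw [target, target, add_sub_add_left_eq_sub]
          exact hF.abs_ciSup_sub_le hg hg' hgg' p.2.2))).1
      rw [excess, excess]
      linarith
    have h3 : ∀ π : Policy X A, M.sqGap π h f g ≤ M.sqGap π h f' g' + 4 * (1 / (T : ℝ)) := by
      intro π
      have hi := hF.integrable_sq_sub_bellman hh hf' hg' (M.occupancy π h)
      have : M.sqGap π h f' g' + 4 * (1 / (T : ℝ))
          = ∫ z, ((f' z.1 z.2 - M.bellman h g' z.1 z.2) ^ 2 + 4 * (1 / (T : ℝ)))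
            ∂(M.occupancy π h) := by
        rw [integral_add hi (integrable_const _)]
        simp [sqGap]
      rw [this]
      refine integral_mono (hF.integrable_sq_sub_bellman hh hf hg _)
        (hi.add (integrable_const _)) fun z => ?_
      exact sq_sub_sq_le (hF.mem01 h f hf _ _) (hF.mem01 h _ hB _ _) (hF.mem01 h f' hf' _ _)
        (hF.mem01 h _ hB' _ _) (hff' _ _) (hbb _ _)
    have hTt : (t : ℝ) * (1 / T) ≤ 1 := by
      rw [mul_one_div, div_le_one hT']
      exact_mod_cast ht.le
    have h4 : ∑ s ∈ Finset.range t, M.excess h f' g' (stepData ⟨h, hh⟩ (episode s ω)) ≤ 12 := by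
      calc _ ≤ ∑ s ∈ Finset.range t, (M.excess h f g (stepData ⟨h, hh⟩ (episode s ω))
              + 12 * (1 / (T : ℝ))) := Finset.sum_le_sum fun s _ => h2 _
        _ ≤ 0 + t * (12 * (1 / (T : ℝ))) := by
            rw [Finset.sum_add_distrib]
            gcongr
            simp
        _ ≤ 12 := by linarith
    -- Discretization costs at most `12` in total excess and `4` in total error, whence `100 (L +
    -- 12/50) + 4 = 28 + 100 L`.
    calc ∑ s ∈ Finset.range t, M.sqError (expl (fhat s ω)) h (fhat t ω)
        = ∑ s ∈ Finset.range t, M.sqGap (expl (fhat s ω)) h f g := rfl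
      _ ≤ ∑ s ∈ Finset.range t, (M.sqGap (expl (fhat s ω)) h f' g' + 4 * (1 / (T : ℝ))) :=
          Finset.sum_le_sum fun s _ => h3 _
      _ = ∑ s ∈ Finset.range t, M.sqGap (expl (fhat s ω)) h f' g' + t * (4 * (1 / (T : ℝ))) := by
          rw [Finset.sum_add_distrib]; simp
      _ ≤ 28 + 100 * L := by
          rw [← Finset.sum_div, ← Finset.sum_div] at h1
          linarith
  -- The last step pairs with `Z M.H`, which the sum omits; its at most one element is dominated by
  -- the nonempty `Z 0`. So the number of pairs is at most the square of the sum.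
  have hcard1 : ∀ h : Fin M.H, ((Z (h + 1)).card : ℝ) ≤ ∑ h : Fin M.H, ((Z h).card : ℝ) := by
    have hs : ∀ h (hh : h < M.H), ((Z h).card : ℝ) ≤ ∑ h : Fin M.H, ((Z h).card : ℝ) := fun h hh =>
      Finset.single_le_sum (f := fun h : Fin M.H => ((Z h).card : ℝ)) (fun i _ => Nat.cast_nonneg _)
        (Finset.mem_univ ⟨h, hh⟩)
    intro h
    by_cases hh : (h : ℕ) + 1 < M.H
    · exact hs _ hh
    · have : (h : ℕ) + 1 = M.H := by omega
      rw [this]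
      have h0 : 1 ≤ (Z 0).card := by
        obtain ⟨f, hf⟩ := hF.nonempty 0
        obtain ⟨f', hf', -⟩ := hcov 0 f hf
        exact Finset.card_pos.2 ⟨f', hf'⟩
      refine le_trans ?_ (hs 0 M.H_pos)
      exact_mod_cast hZH.trans h0
  calc _ ≤ μ (⋃ h : Fin M.H, ⋃ f ∈ Z h, ⋃ g ∈ Z (h + 1), bad h f g : Set Ω) :=
        measure_mono_ae hsub
    _ ≤ ∑ h : Fin M.H, ∑ f ∈ Z h, ∑ g ∈ Z (h + 1), ENNReal.ofReal (Real.exp (-L)) := by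
        refine (measure_iUnion_fintype_le μ _).trans (Finset.sum_le_sum fun h _ => ?_)
        refine (measure_biUnion_finset_le _ _).trans (Finset.sum_le_sum fun f hf => ?_)
        refine (measure_biUnion_finset_le _ _).trans (Finset.sum_le_sum fun g hg => ?_)
        exact hF.measure_sqGap_gt_le hrun hR h (hZ _ _ hf) (hZ _ _ hg) L T
    _ = ENNReal.ofReal (∑ h : Fin M.H, ((Z h).card : ℝ) * ((Z (h + 1)).card * Real.exp (-L))) := by
        rw [ENNReal.ofReal_sum_of_nonneg (fun h _ => by positivity)]
        refine Finset.sum_congr rfl fun h _ => ?_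
        simp [ENNReal.ofReal_mul]
    _ ≤ _ := by
        refine ENNReal.ofReal_le_ofReal ?_
        rw [sq, mul_assoc, Finset.sum_mul]
        gcongr with h _
        exact hcard1 h

end RegularClass

end MDP

/-! ### Counting with the distributional Eluder dimension -/

/-- A sequence of nonnegative weights with bounded row sums can be split into few colours with small
row sums within each colour. -/
lemma exists_coloring (S : Finset ℕ) {w : ℕ → ℕ → ℝ} {β η : ℝ}
    (hβ : ∀ k ∈ S, ∑ j ∈ S with j < k, w j k ≤ β) {B : ℕ}
    (hB : β < (B + 1) * η) :
    ∃ c : ℕ → ℕ, ∀ k ∈ S, c k ≤ B ∧ ∑ j ∈ S with j < k ∧ c j = c k, w j k ≤ η := by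
  have key : ∀ n : ℕ, ∃ c : ℕ → ℕ, ∀ k ∈ S, k < n →
      c k ≤ B ∧ ∑ j ∈ S with j < k ∧ c j = c k, w j k ≤ η := by
    intro n
    induction n with
    | zero => exact ⟨fun _ => 0, fun k _ hk => absurd hk (Nat.not_lt_zero k)⟩
    | succ n ih =>
      obtain ⟨c, hc⟩ := ih
      by_cases hn : n ∈ S
      swap
      · exact ⟨c, fun k hk hkn => hc k hk (lt_of_le_of_ne (Nat.lt_succ_iff.1 hkn)
          fun h => hn (h ▸ hk))⟩
      -- Indices are coloured greedily in increasing order. By pigeonhole some colour is admissible,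
      -- since otherwise the row sum at `n` would be at least `(B + 1) η > β`.
      obtain ⟨L, hL, hLη⟩ : ∃ L ∈ Finset.range (B + 1),
          ∑ j ∈ S with j < n ∧ c j = L, w j n ≤ η := by
        by_contra! hcon
        have h1 : ∑ L ∈ Finset.range (B + 1), ∑ j ∈ (S.filter (· < n)) with c j = L, w j n
            = ∑ j ∈ S with j < n, w j n := by
          refine Finset.sum_fiberwise_of_maps_to (fun j hj => ?_) _
          rw [Finset.mem_filter] at hj
          exact Finset.mem_range.2 (Nat.lt_succ_of_le (hc j hj.1 hj.2).1)
        have h2 : ∑ L ∈ Finset.range (B + 1), η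
            ≤ ∑ L ∈ Finset.range (B + 1), ∑ j ∈ (S.filter (· < n)) with c j = L, w j n :=
          Finset.sum_le_sum fun L hL => by
            rw [Finset.filter_filter]
            exact (hcon L hL).le
        rw [h1, Finset.sum_const, Finset.card_range, nsmul_eq_mul] at h2
        push_cast at h2
        linarith [hβ n hn]
      refine ⟨Function.update c n L, fun k hk hkn => ?_⟩
      have hne : ∀ j, j < k → Function.update c n L j = c j := fun j hj =>
        Function.update_of_ne (by omega) _ _
      have hcongr : ∀ m, ∑ j ∈ S with j < k ∧ Function.update c n L j = m, w j k
          = ∑ j ∈ S with j < k ∧ c j = m, w j k := fun m => by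
        congr 1
        refine Finset.filter_congr fun j _ => and_congr_right fun hj => ?_
        rw [hne j hj]
      rw [hcongr]
      rcases (Nat.lt_succ_iff.1 hkn).lt_or_eq with hlt | rfl
      · rw [Function.update_of_ne hlt.ne]
        exact hc k hk hlt
      · rw [Function.update_self]
        exact ⟨Nat.lt_succ_iff.1 (Finset.mem_range.1 hL), hLη⟩
  obtain ⟨c, hc⟩ := key (S.sup id + 1)
  exact ⟨c, fun k hk => hc k hk (Nat.lt_succ_of_le (Finset.le_sup (f := id) hk))⟩

/-- Enumerated increasingly, `S` is an `ε`-independent sequence, with `g k` witnessing independence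
at `k`. -/
lemma card_le_deDim {Z : Type*} [MeasurableSpace Z] {G : Set (Z → ℝ)} {Pc : Set (Measure Z)}
    {ω ε : ℝ} (hωε : ω ≤ ε) (hε : 0 ≤ ε) {d : ℕ} (hd : deDim G Pc ω ≤ d) {g : ℕ → Z → ℝ}
    {ρ : ℕ → Measure Z} (S : Finset ℕ) (hg : ∀ k ∈ S, g k ∈ G) (hρ : ∀ k ∈ S, ρ k ∈ Pc)
    (hlt : ∀ k ∈ S, ε < |∫ z, g k z ∂(ρ k)|)
    (hle : ∀ k ∈ S, ∑ j ∈ S with j < k, (∫ z, g k z ∂(ρ j)) ^ 2 ≤ ε ^ 2) : S.card ≤ d := by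
  have : (S.card : ℕ∞) ≤ deDim G Pc ω := by
    refine le_sSup ⟨S.card, rfl, fun i => ρ (S.orderEmbOfFin rfl i),
      fun i => hρ _ (S.orderEmbOfFin_mem rfl i), ε, hωε, fun i => ?_⟩
    have hi := S.orderEmbOfFin_mem rfl i
    refine ⟨g (S.orderEmbOfFin rfl i), hg _ hi, ?_, hlt _ hi⟩
    rw [Real.sqrt_le_left hε]
    refine le_trans ?_ (hle _ hi)
    let e : Fin i ↪ ℕ := (Fin.castLEEmb i.isLt.le).trans (S.orderEmbOfFin rfl).toEmbedding
    have h1 : ∑ j : Fin i, (∫ z, g (S.orderEmbOfFin rfl i) z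
          ∂(ρ (S.orderEmbOfFin rfl (j.castLE i.isLt.le)))) ^ 2
        = ∑ x ∈ Finset.univ.map e, (∫ z, g (S.orderEmbOfFin rfl i) z ∂(ρ x)) ^ 2 := by
      rw [Finset.sum_map]
      rfl
    rw [h1]
    refine Finset.sum_le_sum_of_subset_of_nonneg (fun x hx => ?_) fun _ _ _ => sq_nonneg _
    rw [Finset.mem_map] at hx
    obtain ⟨j, -, rfl⟩ := hx
    rw [Finset.mem_filter]
    refine ⟨S.orderEmbOfFin_mem rfl _, (S.orderEmbOfFin rfl).strictMono ?_⟩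
    exact Fin.lt_def.2 j.isLt
  exact_mod_cast this.trans hd

/-- With `⌊β / ε²⌋ + 1` colours, predecessors of the same colour have squared sum at most `ε²`, so
each colour class is an independent sequence and has at most `d` members. -/
lemma card_le_of_sum_sq_le {Z : Type*} [MeasurableSpace Z] {G : Set (Z → ℝ)} {Pc : Set (Measure Z)}
    {ω ε : ℝ} (hωε : ω ≤ ε) (hε : 0 < ε) {d : ℕ} (hd : deDim G Pc ω ≤ d) {g : ℕ → Z → ℝ}
    {ρ : ℕ → Measure Z} (S : Finset ℕ) (hg : ∀ k ∈ S, g k ∈ G) (hρ : ∀ k ∈ S, ρ k ∈ Pc)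
    (hlt : ∀ k ∈ S, ε < |∫ z, g k z ∂(ρ k)|) {β : ℝ} (hβ : 0 ≤ β)
    (hle : ∀ k ∈ S, ∑ j ∈ S with j < k, (∫ z, g k z ∂(ρ j)) ^ 2 ≤ β) :
    (S.card : ℝ) ≤ (β / ε ^ 2 + 1) * d := by
  have hε2 : 0 < ε ^ 2 := by positivity
  set B := ⌊β / ε ^ 2⌋₊ with hB
  obtain ⟨c, hc⟩ := exists_coloring S (w := fun j k => (∫ z, g k z ∂(ρ j)) ^ 2) (β := β)
    (η := ε ^ 2) (B := B) hle
    (by rw [← div_lt_iff₀ hε2]; exact Nat.lt_floor_add_one _)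
  have h1 : S.card = ∑ L ∈ Finset.range (B + 1), (S.filter (c · = L)).card :=
    Finset.card_eq_sum_card_fiberwise fun k hk =>
      Finset.mem_coe.2 (Finset.mem_range.2 (Nat.lt_succ_of_le (hc k hk).1))
  have h2 : S.card ≤ (B + 1) * d := by
    rw [h1]
    refine (Finset.sum_le_card_nsmul _ _ d fun L _ => ?_).trans (by simp)
    refine card_le_deDim hωε hε.le hd _ (fun k hk => hg k (Finset.mem_filter.1 hk).1)
      (fun k hk => hρ k (Finset.mem_filter.1 hk).1) (fun k hk => hlt k (Finset.mem_filter.1 hk).1)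
      fun k hk => ?_
    obtain ⟨hkS, hkL⟩ := Finset.mem_filter.1 hk
    refine le_of_eq_of_le ?_ (hc k hkS).2
    rw [Finset.filter_filter]
    congr 1
    refine Finset.filter_congr fun j _ => ?_
    rw [hkL, and_comm]
  calc (S.card : ℝ) ≤ ((B + 1) * d : ℕ) := by exact_mod_cast h2
    _ = (B + 1) * d := by push_cast; ring
    _ ≤ _ := by
      gcongr
      exact Nat.floor_le (by positivity)

/-- Summation by dyadic layers. -/
lemma sum_le_of_card_layer_le (S : Finset ℕ) {e : ℕ → ℝ} {b β d : ℝ} (hb : 0 < b) (hb1 : b ≤ 1)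
    (hd : 0 ≤ d) (he1 : ∀ k ∈ S, e k ≤ 1)
    (hcard : ∀ ε, b ≤ ε → ((S.filter (ε < e ·)).card : ℝ) ≤ (β / ε ^ 2 + 1) * d) (hβ : 0 ≤ β) :
    ∑ k ∈ S, e k ≤ S.card * b + d * (4 * β / b + 4) := by
  -- The layer `(2^J b, 2^(J+1) b]` contributes at most `d (2β / (2^J b) + 2^(J+1) b)`. Both terms
  -- are geometric in `J`, so no logarithm appears.
  have key : ∀ J : ℕ, ∑ k ∈ S with e k ≤ 2 ^ J * b, e k
      ≤ S.card * b + d * (4 * β / b * (1 - (1 / 2) ^ J) + 2 * b * (2 ^ J - 1)) := by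
    intro J
    induction J with
    | zero =>
      calc ∑ k ∈ S with e k ≤ 2 ^ 0 * b, e k ≤ (S.filter (e · ≤ 2 ^ 0 * b)).card • b :=
            Finset.sum_le_card_nsmul _ _ _ fun k hk => by simpa using (Finset.mem_filter.1 hk).2
        _ ≤ S.card * b := by
            rw [nsmul_eq_mul]
            gcongr
            exact Finset.filter_subset _ _
        _ = _ := by simp
    | succ J ih =>
      have h2J : (0 : ℝ) < 2 ^ J := by positivity
      have hbJ : b ≤ 2 ^ J * b := le_mul_of_one_le_left hb.le (one_le_pow₀ (by norm_num))
      have hsplit : ∑ k ∈ S with e k ≤ 2 ^ (J + 1) * b, e k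
          ≤ (∑ k ∈ S with e k ≤ 2 ^ J * b, e k)
            + (S.filter (2 ^ J * b < e ·)).card * (2 ^ (J + 1) * b) := by
        rw [← Finset.sum_filter_add_sum_filter_not (S.filter (e · ≤ 2 ^ (J + 1) * b))
          (e · ≤ 2 ^ J * b)]
        refine add_le_add (le_of_eq ?_) ?_
        · rw [Finset.filter_filter]
          congr 1
          refine Finset.filter_congr fun k _ => ⟨fun h => h.2, fun h => ⟨h.trans ?_, h⟩⟩
          rw [pow_succ]; nlinarith
        · rw [← nsmul_eq_mul]
          refine (Finset.sum_le_card_nsmul _ _ (2 ^ (J + 1) * b) fun k hk => ?_).trans ?_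
          · exact (Finset.mem_filter.1 (Finset.mem_filter.1 hk).1).2
          · refine nsmul_le_nsmul_left (by positivity) (Finset.card_le_card fun k hk => ?_)
            obtain ⟨h1, h2⟩ := Finset.mem_filter.1 hk
            exact Finset.mem_filter.2 ⟨(Finset.mem_filter.1 h1).1, not_le.1 h2⟩
      refine hsplit.trans ?_
      have h1 := mul_le_mul_of_nonneg_right (hcard (2 ^ J * b) hbJ)
        (by positivity : (0 : ℝ) ≤ 2 ^ (J + 1) * b)
      have h2 : (β / (2 ^ J * b) ^ 2 + 1) * d * (2 ^ (J + 1) * b)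
          = d * (4 * β / b * ((1 / 2) ^ J - (1 / 2) ^ (J + 1)) + 2 * b * (2 ^ (J + 1) - 2 ^ J)) := by
        have e1 : (1 / 2 : ℝ) ^ J = (2 ^ J)⁻¹ := by rw [one_div, inv_pow]
        rw [pow_succ (2 : ℝ) J, pow_succ (1 / 2 : ℝ) J, e1]
        field_simp
        ring
      calc _ ≤ S.card * b + d * (4 * β / b * (1 - (1 / 2) ^ J) + 2 * b * (2 ^ J - 1))
            + d * (4 * β / b * ((1 / 2) ^ J - (1 / 2) ^ (J + 1)) + 2 * b * (2 ^ (J + 1) - 2 ^ J)) :=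
              add_le_add ih (h1.trans_eq h2)
        _ = _ := by ring
  have hex : ∃ J : ℕ, 1 ≤ 2 ^ J * b := by
    obtain ⟨J, hJ⟩ := pow_unbounded_of_one_lt (1 / b) (by norm_num : (1 : ℝ) < 2)
    exact ⟨J, ((div_lt_iff₀ hb).1 hJ).le⟩
  classical
  have hJ := Nat.find_spec hex
  set J := Nat.find hex with hJdef
  -- Minimality of `J` keeps the top layer below `2`, so the increasing geometric sum is at most
  -- `4`.
  have hJ2 : 2 ^ J * b ≤ 2 := by
    rcases Nat.eq_zero_or_pos J with h0 | hpos
    · rw [h0]; linarith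
    · have := Nat.find_min hex (m := J - 1) (by omega)
      obtain ⟨K, hK⟩ : ∃ K, J = K + 1 := ⟨J - 1, by omega⟩
      rw [hK] at this ⊢
      simp only [Nat.add_sub_cancel, not_le] at this
      rw [pow_succ]; linarith
  have h1 := key J
  rw [Finset.filter_true_of_mem fun k hk => (he1 k hk).trans hJ] at h1
  refine h1.trans ?_
  gcongr
  · have : 0 ≤ 4 * β / b := by positivity
    have h3 : (0 : ℝ) ≤ (1 / 2) ^ J := by positivity
    nlinarith
  · nlinarith

lemma sum_abs_integral_le {Z : Type*} [MeasurableSpace Z] {G : Set (Z → ℝ)} {Pc : Set (Measure Z)}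
    {ω b : ℝ} (hωb : ω ≤ b) (hb : 0 < b) (hb1 : b ≤ 1) {d : ℕ} (hd : deDim G Pc ω ≤ d)
    {g : ℕ → Z → ℝ} {ρ : ℕ → Measure Z} (S : Finset ℕ) (hg : ∀ k ∈ S, g k ∈ G)
    (hρ : ∀ k ∈ S, ρ k ∈ Pc) (h1 : ∀ k ∈ S, |∫ z, g k z ∂(ρ k)| ≤ 1) {β : ℝ} (hβ : 0 ≤ β)
    (hle : ∀ k ∈ S, ∑ j ∈ S with j < k, (∫ z, g k z ∂(ρ j)) ^ 2 ≤ β) :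
    ∑ k ∈ S, |∫ z, g k z ∂(ρ k)| ≤ S.card * b + d * (4 * β / b + 4) := by
  refine sum_le_of_card_layer_le S hb hb1 (Nat.cast_nonneg d) h1 (fun ε hε => ?_) hβ
  have hsub := Finset.filter_subset (fun k => ε < |∫ z, g k z ∂(ρ k)|) S
  refine card_le_of_sum_sq_le (hωb.trans hε) (hb.trans_le hε) hd _ (fun k hk => hg k (hsub hk))
    (fun k hk => hρ k (hsub hk)) (fun k hk => (Finset.mem_filter.1 hk).2) hβ fun k hk => ?_
  refine le_trans (Finset.sum_le_sum_of_subset_of_nonneg ?_ fun _ _ _ => sq_nonneg _)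
    (hle k (hsub hk))
  exact Finset.filter_subset_filter _ hsub

lemma sq_integral_le {Z : Type*} [MeasurableSpace Z] {ρ : Measure Z} [IsProbabilityMeasure ρ]
    {g : Z → ℝ} (hg : MemLp g 2 ρ) : (∫ z, g z ∂ρ) ^ 2 ≤ ∫ z, g z ^ 2 ∂ρ := by
  have h1 := variance_nonneg g ρ
  rw [variance_eq_sub hg] at h1
  simpa using h1

/-! ### Episodes with comparable exploration radius -/

namespace MDP

variable {X : Type u} {A : Type v} [MeasurableSpace X] [MeasurableSpace A]
  {M : MDP X A} {F : ℕ → Set (X → A → ℝ)}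

namespace RegularClass

variable (hF : M.RegularClass F)
include hF

lemma sq_integral_residual_le {h : ℕ} (hh : h < M.H) {f : QFun X A} (hf : f ∈ Set.univ.pi F)
    (π : Policy X A) :
    (∫ z, M.residual h f z.1 z.2 ∂(M.occupancy π h)) ^ 2 ≤ M.sqError π h f :=
  sq_integral_le (MemLp.of_bound (hF.measurable_residual hh hf).aestronglyMeasurable 1
    (ae_of_all _ fun z => hF.abs_residual_le hh hf z.1 z.2))

omit hF in
lemma sqError_nonneg (π : Policy X A) (h : ℕ) (f : QFun X A) : 0 ≤ M.sqError π h f :=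
  integral_nonneg fun _ => sq_nonneg _

lemma abs_integral_residual_le {h : ℕ} (hh : h < M.H) {f : QFun X A} (hf : f ∈ Set.univ.pi F)
    (π : Policy X A) : |∫ z, M.residual h f z.1 z.2 ∂(M.occupancy π h)| ≤ 1 := by
  rw [← Real.norm_eq_abs]
  exact (norm_integral_le_of_norm_le_const
    (ae_of_all _ fun z => hF.abs_residual_le hh hf z.1 z.2)).trans (by simp)

/-- The summed Bellman errors along a sequence of policies that the exploration policies cover. -/
lemma sum_abs_residual_le {F' : Set (QFun X A)} (hF' : F' ⊆ Set.univ.pi F)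
    {Pc : Set (MarkovPolicy X A)} {ω b : ℝ} (hωb : ω ≤ b) (hb : 0 < b) (hb1 : b ≤ 1) {d : ℕ}
    (hd : M.beDim F' Pc ω ≤ d) {fh : ℕ → QFun X A} {π : ℕ → MarkovPolicy X A}
    {πe : ℕ → Policy X A} (S : Finset ℕ) (hS : ∀ t ∈ S, fh t ∈ F') (hπ : ∀ t ∈ S, π t ∈ Pc)
    {c β : ℝ} (hc : 0 ≤ c) (hβ : 0 ≤ β) {h : ℕ} (hh : h < M.H)
    (hfeas : ∀ s ∈ S, ∀ f' ∈ Set.univ.pi F,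
      M.sqError (π s).toPolicy h f' ≤ c * M.sqError (πe s) h f')
    (hgood : ∀ t ∈ S, ∑ s ∈ Finset.range t, M.sqError (πe s) h (fh t) ≤ β) :
    ∑ t ∈ S, |∫ z, M.residual h (fh t) z.1 z.2 ∂(M.occupancy (π t).toPolicy h)|
      ≤ S.card * b + d * (4 * (c * β) / b + 4) := by
  have hdh : deDim ((fun f => fun z : X × A => M.residual h f z.1 z.2) '' F')
      ((fun π => M.occupancy π.toPolicy h) '' Pc) ω ≤ d := by
    unfold beDim at hd
    exact iSup_le_iff.1 hd ⟨h, hh⟩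
  refine sum_abs_integral_le
    (g := fun t z => M.residual h (fh t) z.1 z.2) (ρ := fun t => M.occupancy (π t).toPolicy h)
    hωb hb hb1 hdh S
    (fun t ht => Set.mem_image_of_mem _ (hS t ht))
    (fun t ht => Set.mem_image_of_mem (fun π => M.occupancy π.toPolicy h) (hπ t ht))
    (fun t ht => hF.abs_integral_residual_le hh (hF' (hS t ht)) _) (mul_nonneg hc hβ)
    fun t ht => ?_
  have hft := hF' (hS t ht)
  -- Jensen's inequality passes to squared errors, feasibility passes from `π s` to `πe s`, and the
  -- sum is then enlarged to all earlier episodes.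
  calc _ ≤ ∑ s ∈ S with s < t, c * M.sqError (πe s) h (fh t) :=
        Finset.sum_le_sum fun s hs => (hF.sq_integral_residual_le hh hft _).trans
          (hfeas s (Finset.mem_filter.1 hs).1 _ hft)
    _ ≤ ∑ s ∈ Finset.range t, c * M.sqError (πe s) h (fh t) :=
        Finset.sum_le_sum_of_subset_of_nonneg
          (fun s hs => Finset.mem_range.2 (Finset.mem_filter.1 hs).2)
          fun s _ _ => mul_nonneg hc (sqError_nonneg _ _ _)
    _ ≤ c * β := by
        rw [← Finset.mul_sum]
        exact mul_le_mul_of_nonneg_left (hgood t ht) hc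

/-- The number of episodes at which the exploration policy covers, up to a factor of order `c₀`, a
policy that improves on the greedy one by at least `√c₀ α`. -/
lemma card_le_of_radius_class {F' : Set (QFun X A)} (hF' : F' ⊆ Set.univ.pi F)
    {greedy : QFun X A → MarkovPolicy X A}
    (hg : ∀ f ∈ Set.univ.pi F, M.IsGreedy f (greedy f)) {expl : QFun X A → Policy X A}
    {T d : ℕ} (hd1 : 1 ≤ d)
    (hd : M.beDim F' (greedy '' Set.univ.pi F) (1 / √(T : ℝ)) ≤ d) {fh : ℕ → QFun X A}
    (S : Finset ℕ) (hST : ∀ t ∈ S, t < T) (hS : ∀ t ∈ S, fh t ∈ F') {c₀ α β : ℝ} (hc₀ : 1 ≤ c₀)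
    (hα : 0 < α) (hβ : 1 ≤ β)
    (hgood : ∀ t ∈ S, ∀ h < M.H,
      ∑ s ∈ Finset.range t, M.sqError (expl (fh s)) h (fh t) ≤ β)
    (hfeas : ∀ t ∈ S, ∃ π' ∈ greedy '' Set.univ.pi F, ∃ c, c₀ ≤ c ∧ c ≤ 2 * c₀ ∧
      M.GapFeasible F (greedy (fh t)) (expl (fh t)) π' c ∧
      √c * α ≤ M.value π' 0 M.init - M.value (greedy (fh t)) 0 M.init) :
    (S.card : ℝ) ≤ 160 * d * β * (M.H : ℝ) ^ 2 / α ^ 2 := by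
  rcases S.eq_empty_or_nonempty with rfl | hne
  · simp only [Finset.card_empty, Nat.cast_zero]
    positivity
  have : Nonempty (MarkovPolicy X A) := ⟨greedy (fh 0)⟩
  choose! π' hπ'c c hc0 hc2 hfe hgap using hfeas
  have hH : (1 : ℝ) ≤ M.H := by exact_mod_cast M.H_pos
  have hd1' : (1 : ℝ) ≤ d := by exact_mod_cast hd1
  have hval : ∀ t ∈ S, √c₀ * α ≤ ∑ h ∈ Finset.range M.H,
      (|∫ z, M.residual h (fh t) z.1 z.2 ∂(M.occupancy (π' t).toPolicy h)|
        + |∫ z, M.residual h (fh t) z.1 z.2 ∂(M.occupancy (greedy (fh t)).toPolicy h)|) := by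
    intro t ht
    have hft := hF' (hS t ht)
    refine le_trans ?_ ((hgap t ht).trans
      (hF.value_sub_value_le (π' t) (greedy (fh t)) hft (hg _ hft)))
    gcongr
    exact hc0 t ht
  -- The value gap is spread over `2H` mean residuals, so `a` is their guaranteed average.
  set a : ℝ := √c₀ * α / (2 * M.H) with ha
  have hsc : 0 < √c₀ := Real.sqrt_pos.2 (by linarith)
  have ha0 : 0 < a := by positivity
  have haeq : √c₀ * α = 2 * M.H * a := by rw [ha]; field_simp
  have ha2 : a ^ 2 = c₀ * α ^ 2 / (4 * (M.H : ℝ) ^ 2) := by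
    rw [ha, div_pow, mul_pow, Real.sq_sqrt (by linarith)]; ring
  have ha1 : a ≤ 1 := by
    obtain ⟨t, ht⟩ := hne
    have h1 : ∑ h ∈ Finset.range M.H,
        (|∫ z, M.residual h (fh t) z.1 z.2 ∂(M.occupancy (π' t).toPolicy h)|
          + |∫ z, M.residual h (fh t) z.1 z.2 ∂(M.occupancy (greedy (fh t)).toPolicy h)|)
        ≤ ∑ h ∈ Finset.range M.H, (2 : ℝ) := Finset.sum_le_sum fun h hh => by
      have hh' := Finset.mem_range.1 hh
      have hft := hF' (hS t ht)
      linarith [hF.abs_integral_residual_le hh' hft (π' t).toPolicy,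
        hF.abs_integral_residual_le hh' hft (greedy (fh t)).toPolicy]
    have h2 := (hval t ht).trans h1
    rw [haeq, Finset.sum_const, Finset.card_range, nsmul_eq_mul] at h2
    nlinarith
  -- Here `c₀` cancels: `a²` is proportional to `c₀`, and so is the transferred error budget.
  have hfinal : 40 * d * (c₀ * β) / a ^ 2 = 160 * d * β * (M.H : ℝ) ^ 2 / α ^ 2 := by
    rw [ha2]
    field_simp
    ring
  rw [← hfinal]
  have hcβ : 1 ≤ c₀ * β := one_le_mul_of_one_le_of_one_le hc₀ hβ
  have hdcβ : 1 ≤ d * (c₀ * β) := one_le_mul_of_one_le_of_one_le hd1' hcβ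
  -- Threshold `a / 2` lets half of the lower bound `|S| a` absorb the linear term. If `a / 2` is
  -- below the scale `1/√T` of the dimension, the trivial bound `|S| ≤ T ≤ 4 / a²` suffices.
  rcases le_or_gt (1 / √(T : ℝ)) (a / 2) with hω | hω
  · have hb : 0 < a / 2 := by positivity
    have hsum : ∀ π : ℕ → MarkovPolicy X A, (∀ t ∈ S, π t ∈ greedy '' Set.univ.pi F) →
        (∀ s ∈ S, ∀ h < M.H, ∀ f' ∈ Set.univ.pi F,
          M.sqError (π s).toPolicy h f' ≤ c s * M.sqError (expl (fh s)) h f') →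
        ∀ h < M.H,
          ∑ t ∈ S, |∫ z, M.residual h (fh t) z.1 z.2 ∂(M.occupancy (π t).toPolicy h)|
            ≤ S.card * (a / 2) + d * (4 * (2 * c₀ * β) / (a / 2) + 4) := by
      intro π hπ hfe' h hh
      refine hF.sum_abs_residual_le hF' hω hb (by linarith) hd S hS hπ (c := 2 * c₀) (β := β)
        (by positivity) (by positivity) hh (πe := fun s => expl (fh s)) (fun s hs f' hf' => ?_)
        fun t ht => hgood t ht h hh
      exact (hfe' s hs h hh f' hf').trans
        (mul_le_mul_of_nonneg_right (hc2 s hs) (sqError_nonneg _ _ _))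
    have h1 := hsum π' hπ'c fun s hs h hh f' hf' => ((hfe s hs).2 f' hf' h hh).1
    have h2 := hsum (fun t => greedy (fh t)) (fun t ht => ⟨_, hF' (hS t ht), rfl⟩)
      fun s hs h hh f' hf' => ((hfe s hs).2 f' hf' h hh).2
    have h3 : S.card * (2 * M.H * a)
        ≤ 2 * M.H * (S.card * (a / 2) + d * (4 * (2 * c₀ * β) / (a / 2) + 4)) := by
      calc (S.card * (2 * M.H * a) : ℝ)
          = ∑ t ∈ S, √c₀ * α := by rw [Finset.sum_const, nsmul_eq_mul, haeq]
        _ ≤ _ := Finset.sum_le_sum hval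
        _ = ∑ h ∈ Finset.range M.H,
            (∑ t ∈ S, |∫ z, M.residual h (fh t) z.1 z.2 ∂(M.occupancy (π' t).toPolicy h)|
            + ∑ t ∈ S, |∫ z, M.residual h (fh t) z.1 z.2
                ∂(M.occupancy (greedy (fh t)).toPolicy h)|) := by
            rw [Finset.sum_comm]
            simp only [Finset.sum_add_distrib]
        _ ≤ ∑ h ∈ Finset.range M.H,
            2 * (S.card * (a / 2) + d * (4 * (2 * c₀ * β) / (a / 2) + 4)) :=
            Finset.sum_le_sum fun h hh => by
              have hh' := Finset.mem_range.1 hh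
              linarith [h1 h hh', h2 h hh']
        _ = _ := by rw [Finset.sum_const, Finset.card_range, nsmul_eq_mul]; ring
    have h4 : S.card * a ≤ S.card * (a / 2) + d * (4 * (2 * c₀ * β) / (a / 2) + 4) := by
      have hH2 : (0 : ℝ) < 2 * M.H := by positivity
      refine le_of_mul_le_mul_left (le_trans (le_of_eq ?_) h3) hH2
      ring
    -- The additive `4` is absorbed using `a ≤ 1 ≤ c₀ β`, giving `16 + 4 = 20`; absorbing the half
    -- of `|S| a` doubles this to `40`.
    have h5 : 4 * (2 * c₀ * β) / (a / 2) + 4 ≤ 20 * (c₀ * β) / a := by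
      have e1 : 4 * (2 * c₀ * β) / (a / 2) = 16 * (c₀ * β) / a := by field_simp; ring
      have e2 : 4 ≤ 4 * (c₀ * β) / a := by
        rw [le_div_iff₀ ha0]; nlinarith
      rw [e1]
      calc _ ≤ 16 * (c₀ * β) / a + 4 * (c₀ * β) / a := by gcongr
        _ = _ := by ring
    have h6 : S.card * a ≤ 40 * d * (c₀ * β) / a := by
      have h7 := mul_le_mul_of_nonneg_left h5 (Nat.cast_nonneg (α := ℝ) d)
      have e3 : 40 * d * (c₀ * β) / a = 2 * (d * (20 * (c₀ * β) / a)) := by ring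
      rw [e3]
      linarith
    rw [le_div_iff₀ (by positivity), sq, ← mul_assoc]
    rwa [le_div_iff₀ ha0] at h6
  · have hT : 0 < T := by
      obtain ⟨t, ht⟩ := hne
      exact (Nat.zero_le t).trans_lt (hST t ht)
    have hT' : (0 : ℝ) < T := by exact_mod_cast hT
    have hsT : 0 < √(T : ℝ) := Real.sqrt_pos.2 hT'
    have hcard : (S.card : ℝ) ≤ T := by
      have : S ⊆ Finset.range T := fun t ht => Finset.mem_range.2 (hST t ht)
      exact_mod_cast (Finset.card_le_card this).trans (by simp)
    refine hcard.trans ?_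
    rw [le_div_iff₀ (by positivity)]
    rw [lt_div_iff₀ hsT] at hω
    have h1 : (T : ℝ) * a ^ 2 = 4 * (a / 2 * √(T : ℝ)) ^ 2 := by
      rw [mul_pow, Real.sq_sqrt hT'.le]; ring
    have h2 : (a / 2 * √(T : ℝ)) ^ 2 ≤ 1 := pow_le_one₀ (by positivity) hω.le
    rw [h1]
    linarith

end RegularClass

end MDP

/-! ### Covers, radii and the dyadic classes -/

lemma lnPos_ofReal {x : ℝ} (hx : 0 < x) : lnPos (ENNReal.ofReal x) = ENNReal.ofReal (Real.log x) := by
  rw [lnPos, ENNReal.log_ofReal_of_pos hx, EReal.toENNReal_of_ne_top (EReal.coe_ne_top _),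
    EReal.toReal_coe]

lemma lnPos_ne_zero {x : ℝ≥0∞} (hx : 1 < x) : lnPos x ≠ 0 := by
  rw [lnPos, Ne, EReal.toENNReal_eq_zero_iff, not_le]
  exact ENNReal.zero_lt_log_iff.2 hx

@[simp] lemma lnPos_top : lnPos ⊤ = ⊤ := by simp [lnPos]

lemma exists_finset_card_eq_coveringNumber {X : Type u} {A : Type v} {G : Set (X → A → ℝ)}
    {lam : ℝ} (hlam : 0 ≤ lam) (h : coveringNumber G lam ≠ ⊤) :
    ∃ Z : Finset (X → A → ℝ), (∀ f ∈ Z, f ∈ G) ∧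
      (∀ f ∈ G, ∃ f' ∈ Z, ∀ x a, |f x a - f' x a| ≤ lam) ∧ (Z.card : ℕ∞) = coveringNumber G lam := by
  have hne : {k | ∃ Z ⊆ G, (∀ f ∈ G, ∃ f' ∈ Z, ∀ x a, |f x a - f' x a| ≤ lam) ∧
      k = Z.encard}.Nonempty :=
    ⟨_, G, subset_rfl, fun f hf => ⟨f, hf, fun x a => by simpa using hlam⟩, rfl⟩
  obtain ⟨Z, hZG, hZ, hcard⟩ := csInf_mem hne
  have hcard' : coveringNumber G lam = Z.encard := hcard
  have hfin : Z.Finite := by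
    rw [← Set.encard_ne_top_iff, ← hcard']
    exact h
  refine ⟨hfin.toFinset, fun f hf => hZG (hfin.mem_toFinset.1 hf), fun f hf => ?_, ?_⟩
  · obtain ⟨f', hf', hl⟩ := hZ f hf
    exact ⟨f', hfin.mem_toFinset.2 hf', hl⟩
  · rw [hcard', hfin.encard_eq_coe_toFinset_card]

lemma one_le_coveringNumber {X : Type u} {A : Type v} {G : Set (X → A → ℝ)} (hG : G.Nonempty)
    (lam : ℝ) : 1 ≤ coveringNumber G lam := by
  refine le_sInf ?_
  rintro _ ⟨Z, -, hZ, rfl⟩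
  obtain ⟨f, hf⟩ := hG
  obtain ⟨f', hf', -⟩ := hZ f hf
  exact Set.one_le_encard_iff_nonempty.2 ⟨f', hf'⟩

namespace MDP

variable {X : Type u} {A : Type v} [MeasurableSpace X] [MeasurableSpace A]
  {M : MDP X A} {F : ℕ → Set (X → A → ℝ)}

/-- A feasible pair attaining the gap of `f`, with `c` below any bound on the radius. -/
lemma exists_feasible_of_radius_lt {greedy : QFun X A → MarkovPolicy X A}
    {expl : QFun X A → Policy X A} {Pc : Set (MarkovPolicy X A)} {f : QFun X A} {α b : ℝ}
    (hα : α ≤ M.gap F Pc greedy expl f) (hb : M.radius F Pc greedy expl f < ENNReal.ofReal b) :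
    ∃ π' ∈ Pc, ∃ c, c < b ∧ M.GapFeasible F (greedy f) (expl f) π' c ∧
      √c * α ≤ M.value π' 0 M.init - M.value (greedy f) 0 M.init := by
  -- Members of the set defining the radius have objective equal to the gap, so nothing about
  -- boundedness of the supremum in `gap` is needed.
  obtain ⟨v, ⟨π', hπ', c, hfe, hobj, rfl⟩, hlt⟩ := sInf_lt_iff.1 hb
  refine ⟨π', hπ', c, (ENNReal.ofReal_lt_ofReal_iff_of_nonneg (by linarith [hfe.1])).1 hlt, hfe, ?_⟩
  have hc : 0 < √c := Real.sqrt_pos.2 (by linarith [hfe.1])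
  rw [← hobj, gapObjective, one_div_mul_eq_div, le_div_iff₀ hc] at hα
  linarith

lemma one_le_radius (greedy : QFun X A → MarkovPolicy X A) (expl : QFun X A → Policy X A)
    (Pc : Set (MarkovPolicy X A)) (f : QFun X A) : 1 ≤ M.radius F Pc greedy expl f := by
  refine le_sInf ?_
  rintro _ ⟨π', -, c, hfe, -, rfl⟩
  exact ENNReal.one_le_ofReal.2 hfe.1

lemma RegularClass.one_le_sumCovering (hF : M.RegularClass F) (lam : ℝ) :
    1 ≤ M.sumCovering F lam :=
  (one_le_coveringNumber (hF.nonempty 0) lam).trans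
    (Finset.single_le_sum (f := fun h : Fin M.H => coveringNumber (F h) lam)
      (fun _ _ => zero_le) (Finset.mem_univ ⟨0, M.H_pos⟩))

/-- The regression at the last step also involves `F M.H`, which the covering sum omits; it is
covered by its single element. -/
lemma RegularClass.exists_cover (hF : M.RegularClass F) {lam : ℝ} (hlam : 0 ≤ lam)
    (h : M.sumCovering F lam ≠ ⊤) :
    ∃ Z : ℕ → Finset (X → A → ℝ), (∀ h, ∀ f ∈ Z h, f ∈ F h) ∧
      (∀ h, ∀ f ∈ F h, ∃ f' ∈ Z h, ∀ x a, |f x a - f' x a| ≤ lam) ∧ (Z M.H).card ≤ 1 ∧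
      ((∑ h : Fin M.H, (Z h).card : ℕ) : ℕ∞) = M.sumCovering F lam := by
  have hex : ∀ k, ∃ Z : Finset (X → A → ℝ), (∀ f ∈ Z, f ∈ F k) ∧
      (∀ f ∈ F k, ∃ f' ∈ Z, ∀ x a, |f x a - f' x a| ≤ lam) ∧
      (k < M.H → (Z.card : ℕ∞) = coveringNumber (F k) lam) ∧ (M.H ≤ k → Z.card ≤ 1) := by
    intro k
    by_cases hk : k < M.H
    · have hne : coveringNumber (F k) lam ≠ ⊤ := by
        intro htop
        apply h
        rw [sumCovering, eq_top_iff, ← htop]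
        exact Finset.single_le_sum (f := fun h : Fin M.H => coveringNumber (F h) lam)
          (fun _ _ => zero_le) (Finset.mem_univ ⟨k, hk⟩)
      obtain ⟨Z, h1, h2, h3⟩ := exists_finset_card_eq_coveringNumber hlam hne
      exact ⟨Z, h1, h2, fun _ => h3, fun h' => absurd hk (not_lt.2 h')⟩
    · have h0 := hF.zero k (not_lt.1 hk)
      refine ⟨{fun _ _ => 0}, fun f hf => ?_, fun f hf => ?_, fun h' => absurd h' hk, fun _ => ?_⟩
      · rw [h0]; exact Finset.mem_singleton.1 hf
      · rw [h0] at hf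
        refine ⟨f, Finset.mem_singleton.2 hf, fun x a => by simpa using hlam⟩
      · simp
  choose Z h1 h2 h3 h4 using hex
  refine ⟨Z, h1, h2, h4 _ le_rfl, ?_⟩
  rw [sumCovering, Nat.cast_sum]
  exact Finset.sum_congr rfl fun k _ => h3 k k.isLt

/-- The number of episodes in `F'`, on the event that all Bellman errors are small. -/
lemma RegularClass.card_le_of_sqError_le (hF : M.RegularClass F) {F' : Set (QFun X A)}
    (hF' : F' ⊆ Set.univ.pi F) {greedy : QFun X A → MarkovPolicy X A}
    (hg : ∀ f ∈ Set.univ.pi F, M.IsGreedy f (greedy f)) {expl : QFun X A → Policy X A}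
    {T d : ℕ} (hd1 : 1 ≤ d)
    (hd : M.beDim F' (greedy '' Set.univ.pi F) (1 / √(T : ℝ)) ≤ d) {fh : ℕ → QFun X A}
    {α r β : ℝ} (hα : 0 < α) (hβ : 1 ≤ β) (hr : 1 ≤ r)
    (hαF : M.minGap F greedy expl F' = ENNReal.ofReal α)
    (hrF : M.maxRadius F greedy expl F' = ENNReal.ofReal r)
    (hgood : ∀ t < T, ∀ h < M.H,
      ∑ s ∈ Finset.range t, M.sqError (expl (fh s)) h (fh t) ≤ β) :
    ({t : ℕ | t < T ∧ fh t ∈ F'}.ncard : ℝ)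
      ≤ 320 * (1 + Real.log r) * (d * β * (M.H : ℝ) ^ 2 / α ^ 2) := by
  classical
  set S : Finset ℕ := (Finset.range T).filter (fh · ∈ F') with hS
  have hSset : {t : ℕ | t < T ∧ fh t ∈ F'} = (S : Set ℕ) := by
    ext t; simp [hS]
  rw [hSset, Set.ncard_coe_finset]
  have hST : ∀ t ∈ S, t < T := fun t ht => Finset.mem_range.1 (Finset.mem_filter.1 ht).1
  have hSF : ∀ t ∈ S, fh t ∈ F' := fun t ht => (Finset.mem_filter.1 ht).2
  -- The radius is an infimum that need not be attained; the slack `+ 1` yields an actual feasible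
  -- pair.
  have hex : ∀ t ∈ S, ∃ π' ∈ greedy '' Set.univ.pi F, ∃ c, c < r + 1 ∧
      M.GapFeasible F (greedy (fh t)) (expl (fh t)) π' c ∧
      √c * α ≤ M.value π' 0 M.init - M.value (greedy (fh t)) 0 M.init := by
    intro t ht
    refine exists_feasible_of_radius_lt ?_ ?_
    · have h1 : ENNReal.ofReal α
          ≤ ENNReal.ofReal (M.gap F (greedy '' Set.univ.pi F) greedy expl (fh t)) := by
        rw [← hαF]
        exact iInf₂_le (fh t) (hSF t ht)
      exact (ENNReal.ofReal_le_ofReal_iff' .. |>.1 h1).resolve_right (not_le.2 hα)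
    · calc _ ≤ M.maxRadius F greedy expl F' :=
            le_iSup₂ (f := fun f (_ : f ∈ F') =>
              M.radius F (greedy '' Set.univ.pi F) greedy expl f) (fh t) (hSF t ht)
        _ < _ := by
            rw [hrF]
            exact (ENNReal.ofReal_lt_ofReal_iff (by linarith)).2 (by linarith)
  have : Nonempty (MarkovPolicy X A) := ⟨greedy (fh 0)⟩
  choose! π' hπ' c hcr hfe hgap using hex
  have hc1 : ∀ t ∈ S, 1 ≤ c t := fun t ht => (hfe t ht).1
  set i : ℕ → ℕ := fun t => Nat.log 2 ⌊c t⌋₊ with hi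
  have hilow : ∀ t ∈ S, (2 : ℝ) ^ i t ≤ c t := fun t ht => by
    have h1 : ⌊c t⌋₊ ≠ 0 := (Nat.floor_pos.2 (hc1 t ht)).ne'
    have h2 : ((2 ^ i t : ℕ) : ℝ) ≤ ⌊c t⌋₊ := by exact_mod_cast Nat.pow_log_le_self 2 h1
    push_cast at h2
    exact h2.trans (Nat.floor_le (by linarith [hc1 t ht]))
  have hihigh : ∀ t ∈ S, c t ≤ 2 * (2 : ℝ) ^ i t := fun t ht => by
    have h1 : ⌊c t⌋₊ + 1 ≤ 2 ^ (i t + 1) := Nat.lt_pow_succ_log_self (by norm_num) _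
    have h2 : ((⌊c t⌋₊ + 1 : ℕ) : ℝ) ≤ ((2 ^ (i t + 1) : ℕ) : ℝ) := by exact_mod_cast h1
    push_cast at h2
    rw [pow_succ] at h2
    linarith [Nat.lt_floor_add_one (c t)]
  have hlog : 0 ≤ Real.log r := Real.log_nonneg hr
  -- From `2^i ≤ c < r + 1 ≤ 2r` follows `i ≤ 1 + log₂ r`, and `ln 2 > 1/2` bounds this by `1 + 2 ln
  -- r`.
  set B := ⌊1 + 2 * Real.log r⌋₊ with hB
  have hiB : ∀ t ∈ S, i t ∈ Finset.range (B + 1) := fun t ht => by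
    rw [Finset.mem_range, Nat.lt_succ_iff]
    refine Nat.le_floor ?_
    have h1 : (2 : ℝ) ^ i t ≤ 2 * r := by linarith [hilow t ht, hcr t ht]
    have h2 := Real.log_le_log (by positivity) h1
    rw [Real.log_pow, Real.log_mul (by norm_num) (by linarith)] at h2
    have h3 := Real.log_two_gt_d9
    by_contra! hcon
    have h4 : (1 + 2 * Real.log r) * Real.log 2 < i t * Real.log 2 :=
      mul_lt_mul_of_pos_right hcon (by linarith)
    nlinarith
  set K : ℝ := d * β * (M.H : ℝ) ^ 2 / α ^ 2 with hK
  have hK0 : 0 ≤ K := by positivity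
  have hclass : ∀ L, ((S.filter (i · = L)).card : ℝ) ≤ 160 * K := by
    intro L
    have hsub := Finset.filter_subset (i · = L) S
    refine (hF.card_le_of_radius_class hF' hg hd1 hd (S.filter (i · = L))
      (fun t ht => hST t (hsub ht)) (fun t ht => hSF t (hsub ht)) (c₀ := 2 ^ L)
      (one_le_pow₀ (by norm_num)) hα hβ (fun t ht => hgood t (hST t (hsub ht)))
      fun t ht => ?_).trans (le_of_eq ?_)
    · have htS := hsub ht
      have htL := (Finset.mem_filter.1 ht).2
      refine ⟨π' t, hπ' t htS, c t, ?_, ?_, hfe t htS, hgap t htS⟩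
      · rw [← htL]; exact hilow t htS
      · rw [← htL]; exact hihigh t htS
    · rw [hK]; ring
  have hcount : (S.card : ℝ) ≤ (B + 1) * (160 * K) := by
    rw [Finset.card_eq_sum_card_fiberwise hiB, Nat.cast_sum]
    refine (Finset.sum_le_card_nsmul _ _ (160 * K) fun L _ => hclass L).trans (le_of_eq ?_)
    rw [Finset.card_range, nsmul_eq_mul]
    push_cast
    ring
  have hBle : (B : ℝ) ≤ 1 + 2 * Real.log r := Nat.floor_le (by linarith)
  calc (S.card : ℝ) ≤ (B + 1) * (160 * K) := hcount
    _ ≤ (1 + 2 * Real.log r + 1) * (160 * K) := by gcongr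
    _ = _ := by ring

end MDP

/-! ### Constants and the final bound -/

/-- The absolute constant of the sample complexity bound. -/
def sampleConst : ℝ := 320 * (28 / Real.log (Real.log 3) + 200)

lemma log_log_three_pos : 0 < Real.log (Real.log 3) := by
  refine Real.log_pos ?_
  rw [Real.lt_log_iff_exp_lt (by norm_num)]
  exact Real.exp_one_lt_three

lemma sampleConst_pos : 0 < sampleConst := by
  have := log_log_three_pos
  unfold sampleConst
  positivity

lemma mul_eq_top_of_factor {C p q r s : ℝ≥0∞} (hC : C ≠ 0) (hp : p ≠ 0) (hq : q ≠ 0)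
    (hr : r ≠ 0) (hs : s ≠ 0) (h : p = ⊤ ∨ r = ⊤ ∨ s = ⊤) : C * (p * q * r * s) = ⊤ := by
  rcases h with rfl | rfl | rfl <;> simp [*]

namespace MDP

variable {X : Type u} {A : Type v} {Ω : Type w} [MeasurableSpace X] [MeasurableSpace A]
  [mΩ : MeasurableSpace Ω] {M : MDP X A} {F : ℕ → Set (X → A → ℝ)}
  {expl : QFun X A → Policy X A} {μ : Measure Ω} {ℱ : Filtration ℕ mΩ}
  {episode : ℕ → Ω → Hist X A M.H} {fhat : ℕ → Ω → QFun X A}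

/-- The sample complexity bound in real numbers, when all its ingredients are finite. -/
lemma RegularClass.measure_card_gt_le [IsProbabilityMeasure μ] (hF : M.RegularClass F)
    (hR : M.RewardsBounded) (hrun : M.IsRun F expl μ ℱ episode fhat) {F' : Set (QFun X A)}
    (hF' : F' ⊆ Set.univ.pi F) {greedy : QFun X A → MarkovPolicy X A}
    (hg : ∀ f ∈ Set.univ.pi F, M.IsGreedy f (greedy f)) {T d N : ℕ} (hT : 3 ≤ T) (hd1 : 1 ≤ d)
    (hd : M.beDim F' (greedy '' Set.univ.pi F) (1 / √(T : ℝ)) ≤ d)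
    (hN : M.sumCovering F (1 / (T : ℝ)) = N) {α r δ : ℝ} (hα : 0 < α) (hr : 1 ≤ r)
    (hδ : 0 < δ) (hδ1 : δ < 1)
    (hαF : M.minGap F greedy expl F' = ENNReal.ofReal α)
    (hrF : M.maxRadius F greedy expl F' = ENNReal.ofReal r) :
    μ {ω | ¬ (({t : ℕ | t < T ∧ fhat t ω ∈ F'}.ncard : ℝ)
        ≤ sampleConst * ((1 + Real.log r) / α ^ 2 * (M.H : ℝ) ^ 2 * d
          * Real.log (N * (Real.log T / δ))))} ≤ ENNReal.ofReal δ := by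
  have hN1 : (1 : ℝ) ≤ N := by
    have := hF.one_le_sumCovering (1 / (T : ℝ))
    rw [hN] at this
    exact_mod_cast this
  have hT3 : (3 : ℝ) ≤ T := by exact_mod_cast hT
  obtain ⟨Z, hZF, hcov, hZH, hZN⟩ := hF.exists_cover (lam := 1 / (T : ℝ)) (by positivity)
    (by rw [hN]; exact ENat.natCast_ne_top N)
  have hsumN : (∑ h : Fin M.H, ((Z h).card : ℝ)) = N := by
    rw [hN] at hZN
    exact_mod_cast hZN
  set κ := Real.log (Real.log 3) with hκ
  have hκ0 : 0 < κ := log_log_three_pos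
  have hlog3 : 1 < Real.log 3 := by
    rw [Real.lt_log_iff_exp_lt (by norm_num)]
    exact Real.exp_one_lt_three
  have hlogT : Real.log 3 ≤ Real.log T := Real.log_le_log (by norm_num) hT3
  have hlogT0 : 0 < Real.log T := by linarith
  set Λ := Real.log (N * (Real.log T / δ)) with hΛ
  -- As `N ≥ 1`, `T ≥ 3` and `δ < 1`, the argument of the logarithm is at least `ln 3 > 1`. So `Λ`
  -- exceeds a positive absolute constant, and the additive `28` becomes a multiple of `Λ`.
  have hκΛ : κ ≤ Λ := by
    refine Real.log_le_log (by linarith) ?_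
    have h1 : Real.log T ≤ Real.log T / δ := by
      rw [le_div_iff₀ hδ]; nlinarith
    nlinarith
  -- Chosen so that the union bound `N² exp(-L)` over pairs of centers equals `δ`.
  set L := Real.log ((N : ℝ) ^ 2 / δ) with hL
  have hL0 : 0 ≤ L := Real.log_nonneg (by rw [le_div_iff₀ hδ]; nlinarith)
  have hLΛ : L ≤ 2 * Λ := by
    have h1 : 2 * Λ = Real.log ((N * (Real.log T / δ)) ^ 2) := by
      rw [Real.log_pow, hΛ]; norm_num
    rw [h1]
    refine Real.log_le_log (by positivity) ?_
    have h2 : 1 / δ ≤ (Real.log T / δ) ^ 2 := by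
      rw [div_pow, div_le_div_iff₀ hδ (by positivity)]
      have : 1 ≤ Real.log T ^ 2 := by nlinarith
      nlinarith
    rw [mul_pow, div_eq_mul_one_div]
    gcongr
  have hmain := hF.measure_sqError_le hrun hR (by omega : 0 < T) Z hZF hcov hZH L
  have hδeq : (∑ h : Fin M.H, ((Z h).card : ℝ)) ^ 2 * Real.exp (-L) = δ := by
    have hN0 : (0 : ℝ) < N := by linarith
    rw [hsumN, Real.exp_neg, hL, Real.exp_log (by positivity)]
    field_simp
  rw [hδeq] at hmain
  refine (measure_mono (Set.ofPred_subset_ofPred.2 fun ω hω hgood => hω ?_)).trans hmain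
  have hβ := hF.card_le_of_sqError_le hF' hg hd1 hd (fh := fun t => fhat t ω) (expl := expl)
    (β := 28 + 100 * L) hα (by linarith) hr hαF hrF fun t ht => (hgood t ht).2
  refine hβ.trans ?_
  have h28 : 28 ≤ 28 / κ * Λ := by
    rw [div_mul_eq_mul_div, le_div_iff₀ hκ0]; linarith
  have hβΛ : 28 + 100 * L ≤ (28 / κ + 200) * Λ := by linarith
  have hlogr : 0 ≤ Real.log r := Real.log_nonneg hr
  calc 320 * (1 + Real.log r) * (d * (28 + 100 * L) * (M.H : ℝ) ^ 2 / α ^ 2)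
      ≤ 320 * (1 + Real.log r) * (d * ((28 / κ + 200) * Λ) * (M.H : ℝ) ^ 2 / α ^ 2) := by gcongr
    _ = _ := by rw [sampleConst]; ring

end MDP

end MyopicRL

end

theorem mainTheorem1 :
    ∃ C : ℝ≥0, 0 < C ∧
      ∀ (X : Type*) (A : Type*) (Ω : Type*) [MeasurableSpace X] [MeasurableSpace A]
        [mΩ : MeasurableSpace Ω]
        (M : MyopicRL.MDP X A) (_ : M.RewardsBounded)
        (F : ℕ → Set (X → A → ℝ)) (_ : M.IsValueClass F)
        (_ : M.Realizable F) (_ : M.BellmanComplete F)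
        (greedy : MyopicRL.QFun X A → MyopicRL.MarkovPolicy X A)
        (_ : ∀ f ∈ Set.univ.pi F, M.IsGreedy f (greedy f))
        (expl : MyopicRL.QFun X A → MyopicRL.Policy X A)
        (μ : Measure Ω) [IsProbabilityMeasure μ] (ℱ : Filtration ℕ mΩ)
        (episode : ℕ → Ω → MyopicRL.Hist X A M.H) (fhat : ℕ → Ω → MyopicRL.QFun X A)
        (_ : M.IsRun F expl μ ℱ episode fhat)
        (F' : Set (MyopicRL.QFun X A)) (_ : F' ⊆ Set.univ.pi F)
        (δ : ℝ) (_ : 0 < δ) (_ : δ < 1) (T : ℕ) (_ : 3 ≤ T),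
        μ {ω | ¬ (({t : ℕ | t < T ∧ fhat t ω ∈ F'}.ncard : ℝ≥0∞) ≤
            C * ((1 + MyopicRL.lnPos (M.maxRadius F greedy expl F')) /
                  (M.minGap F greedy expl F') ^ 2
              * (M.H : ℝ≥0∞) ^ 2
              * max ((M.beDim F' (greedy '' Set.univ.pi F) (1 / √(T : ℝ)) : ℕ∞) : ℝ≥0∞) 1
              * MyopicRL.lnPos (((M.sumCovering F (1 / (T : ℝ)) : ℕ∞) : ℝ≥0∞)
                  * ENNReal.ofReal (Real.log T / δ))))}
          ≤ ENNReal.ofReal δ := by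
  refine ⟨Real.toNNReal MyopicRL.sampleConst, Real.toNNReal_pos.2 MyopicRL.sampleConst_pos, ?_⟩
  intro X A Ω _ _ mΩ M hR F hV hQ hC greedy hg expl μ _ ℱ episode fhat hrun F' hF' δ hδ hδ1 T hT
  have hF := MyopicRL.MDP.regularClass hV hQ hC hg
  -- For empty `F'` the count is zero. A member `f₀` is needed afterwards, since an infimum over
  -- nothing would make the gap `⊤` and a supremum over nothing the radius `0`.
  rcases F'.eq_empty_or_nonempty with rfl | ⟨f₀, hf₀⟩
  · simp
  have hC0 : ((Real.toNNReal MyopicRL.sampleConst : ℝ≥0) : ℝ≥0∞) ≠ 0 := by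
    simpa using MyopicRL.sampleConst_pos
  have hgap : M.minGap F greedy expl F' ≠ ⊤ :=
    ne_top_of_le_ne_top ENNReal.ofReal_ne_top (iInf₂_le f₀ hf₀)
  have hrad : 1 ≤ M.maxRadius F greedy expl F' :=
    (MyopicRL.MDP.one_le_radius greedy expl _ f₀).trans
      (le_iSup₂ (f := fun f (_ : f ∈ F') =>
        M.radius F (greedy '' Set.univ.pi F) greedy expl f) f₀ hf₀)
  have hT3 : (3 : ℝ) ≤ T := by exact_mod_cast hT
  have hlogT : 1 < Real.log T := by
    rw [Real.lt_log_iff_exp_lt (by linarith)]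
    exact Real.exp_one_lt_three.trans_le hT3
  have hlogδ : 1 < Real.log T / δ := by
    rw [lt_div_iff₀ hδ]; linarith
  have hN1 : (1 : ℝ≥0∞) ≤ ((M.sumCovering F (1 / (T : ℝ)) : ℕ∞) : ℝ≥0∞) := by
    exact_mod_cast hF.one_le_sumCovering (1 / (T : ℝ))
  have hs : MyopicRL.lnPos (((M.sumCovering F (1 / (T : ℝ)) : ℕ∞) : ℝ≥0∞)
      * ENNReal.ofReal (Real.log T / δ)) ≠ 0 :=
    MyopicRL.lnPos_ne_zero (lt_of_lt_of_le (ENNReal.one_lt_ofReal.2 hlogδ)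
      (le_mul_of_one_le_left (zero_le) hN1))
  have hq : ((M.H : ℝ≥0∞)) ^ 2 ≠ 0 := pow_ne_zero _ (Nat.cast_ne_zero.2 M.H_pos.ne')
  have hr : max ((M.beDim F' (greedy '' Set.univ.pi F) (1 / √(T : ℝ)) : ℕ∞) : ℝ≥0∞) 1 ≠ 0 :=
    (lt_of_lt_of_le one_pos (le_max_right _ _)).ne'
  have hp : (1 + MyopicRL.lnPos (M.maxRadius F greedy expl F')) / (M.minGap F greedy expl F') ^ 2
      ≠ 0 := ENNReal.div_ne_zero.2 ⟨(lt_of_lt_of_le one_pos le_self_add).ne',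
        ENNReal.pow_ne_top hgap⟩
  -- All factors are nonzero, so the convention `0 · ∞ = 0` cannot interfere: one infinite factor
  -- makes the whole bound infinite and the claim trivial.
  by_cases hinf : (1 + MyopicRL.lnPos (M.maxRadius F greedy expl F'))
        / (M.minGap F greedy expl F') ^ 2 = ⊤ ∨
      max ((M.beDim F' (greedy '' Set.univ.pi F) (1 / √(T : ℝ)) : ℕ∞) : ℝ≥0∞) 1 = ⊤ ∨
      MyopicRL.lnPos (((M.sumCovering F (1 / (T : ℝ)) : ℕ∞) : ℝ≥0∞)
        * ENNReal.ofReal (Real.log T / δ)) = ⊤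
  · rw [MyopicRL.mul_eq_top_of_factor hC0 hp hq hr hs hinf]
    simp
  push Not at hinf
  obtain ⟨hp', hr', hs'⟩ := hinf
  have hrad' : M.maxRadius F greedy expl F' ≠ ⊤ := fun h => hp' (by
    rw [h, MyopicRL.lnPos_top, add_top, ENNReal.top_div_of_ne_top (ENNReal.pow_ne_top hgap)])
  have hgap' : M.minGap F greedy expl F' ≠ 0 := fun h => hp' (by
    rw [h, zero_pow two_ne_zero, ENNReal.div_zero (lt_of_lt_of_le one_pos le_self_add).ne'])
  have hdim : M.beDim F' (greedy '' Set.univ.pi F) (1 / √(T : ℝ)) ≠ ⊤ := fun h => hr' (by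
    rw [h]; simp)
  have hcov : M.sumCovering F (1 / (T : ℝ)) ≠ ⊤ := fun h => hs' (by
    rw [h, ENat.toENNReal_top, ENNReal.top_mul (by simpa using by linarith), MyopicRL.lnPos_top])
  obtain ⟨d, hd⟩ := ENat.ne_top_iff_exists.1 hdim
  obtain ⟨N, hN⟩ := ENat.ne_top_iff_exists.1 hcov
  obtain ⟨α, hα, hαF⟩ : ∃ α : ℝ, 0 < α ∧ M.minGap F greedy expl F' = ENNReal.ofReal α :=
    ⟨_, ENNReal.toReal_pos hgap' hgap, (ENNReal.ofReal_toReal hgap).symm⟩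
  obtain ⟨r, hr1, hrF⟩ : ∃ r : ℝ, 1 ≤ r ∧ M.maxRadius F greedy expl F' = ENNReal.ofReal r :=
    ⟨_, by simpa using ENNReal.toReal_mono hrad' hrad, (ENNReal.ofReal_toReal hrad').symm⟩
  -- The dimension is raised to `max d 1`, as the real bound requires it to be at least `1`.
  have hmain := hF.measure_card_gt_le hR hrun hF' hg hT (le_max_right d 1) (N := N)
    (hd.symm.trans_le (by exact_mod_cast le_max_left d 1)) hN.symm hα hr1 hδ hδ1 hαF hrF
  have hN1' : (1 : ℝ) ≤ N := by
    rw [← hN] at hN1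
    exact_mod_cast hN1
  have hlogr := Real.log_nonneg hr1
  have harg : 0 < (N : ℝ) * (Real.log T / δ) := by positivity
  have hmax : max (((d : ℕ∞)) : ℝ≥0∞) 1 = ENNReal.ofReal ((max d 1 : ℕ) : ℝ) := by
    rw [ENNReal.ofReal_natCast, (Nat.mono_cast (α := ℝ≥0∞)).map_max, Nat.cast_one,
      ENat.toENNReal_coe]
  have hbound : ((Real.toNNReal MyopicRL.sampleConst : ℝ≥0) : ℝ≥0∞)
      * ((1 + MyopicRL.lnPos (M.maxRadius F greedy expl F')) / (M.minGap F greedy expl F') ^ 2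
        * (M.H : ℝ≥0∞) ^ 2
        * max ((M.beDim F' (greedy '' Set.univ.pi F) (1 / √(T : ℝ)) : ℕ∞) : ℝ≥0∞) 1
        * MyopicRL.lnPos (((M.sumCovering F (1 / (T : ℝ)) : ℕ∞) : ℝ≥0∞)
          * ENNReal.ofReal (Real.log T / δ)))
      = ENNReal.ofReal (MyopicRL.sampleConst * ((1 + Real.log r) / α ^ 2 * (M.H : ℝ) ^ 2
        * (max d 1 : ℕ) * Real.log (N * (Real.log T / δ)))) := by
    have e1 : (((N : ℕ∞)) : ℝ≥0∞) * ENNReal.ofReal (Real.log T / δ)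
        = ENNReal.ofReal (N * (Real.log T / δ)) := by
      rw [ENNReal.ofReal_mul (Nat.cast_nonneg N), ENNReal.ofReal_natCast]
      simp
    rw [hαF, hrF, ← hd, ← hN, hmax, e1, MyopicRL.lnPos_ofReal harg,
      MyopicRL.lnPos_ofReal (by linarith), ENNReal.ofReal_mul MyopicRL.sampleConst_pos.le,
      ENNReal.ofReal_mul (by positivity), ENNReal.ofReal_mul (by positivity),
      ENNReal.ofReal_mul (by positivity), ENNReal.ofReal_div_of_pos (by positivity),
      ENNReal.ofReal_add one_pos.le hlogr, ENNReal.ofReal_one, ENNReal.ofReal_pow hα.le,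
      ENNReal.ofReal_pow (Nat.cast_nonneg _), ENNReal.ofReal_natCast M.H]
    rfl
  rw [hbound]
  refine (measure_mono (Set.ofPred_subset_ofPred.2 fun ω hω hle => hω ?_)).trans hmain
  rw [← ENNReal.ofReal_natCast]
  exact ENNReal.ofReal_le_ofReal hle
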